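/- Let $k$ be a commutative ring, $\otimes=\otimes_k$. A *monoidal Hom-Hopf algebra* $(H,\alpha)$ is a $k$-module $H$ with a $k$-automorphism $\alpha$, a product, an element $1$, a coproduct $\Delta(h)=h_1\otimes h_2$, a counit $\varepsilon$ and an antipode $S$ (all $k$-linear and compatible with $\alpha$) such that $\alpha(a)(bc)=(ab)\alpha(c)$, $a1=1a=\alpha(a)$, $\alpha^{-1}(c_1)\otimes\Delta(c_2)=c_{11}\otimes(c_{12}\otimes\alpha^{-1}(c_2))$, $c_1\varepsilon(c_2)=\alpha^{-1}(c)=\varepsilon(c_1)c_2$, $\Delta$ and $\varepsilon$ are multiplicative and unital, and $S(h_1)h_2=\varepsilon(h)1=h_1S(h_2)$. A *bicovariant $(H,\alpha)$-Hom-bimodule* is a $k$-module $M$ with a $k$-automorphism $\mu$ and $k$-linear left and right actions and coactions $\rho(m)=m_{(-1)}\otimes m_{(0)}\in H\otimes M$, $\sigma(m)=m_{[0]}\otimes m_{[1]}\in M\otimes H$, all compatible with $\mu,\alpha$, such that $\alpha(g)(hm)=(gh)\mu(m)$, $1m=\mu(m)$, $(mg)\alpha(h)=\mu(m)(gh)$,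 $m1=\mu(m)$, $(gm)\alpha(h)=\alpha(g)(mh)$; $\alpha^{-1}(m_{(-1)})\otimes\rho(m_{(0)})=m_{(-1)1}\otimes(m_{(-1)2}\otimes\mu^{-1}(m_{(0)}))$, $\varepsilon(m_{(-1)})m_{(0)}=\mu^{-1}(m)$; $\mu^{-1}(m_{[0]})\otimes\Delta(m_{[1]})=m_{[0][0]}\otimes(m_{[0][1]}\otimes\alpha^{-1}(m_{[1]}))$, $m_{[0]}\varepsilon(m_{[1]})=\mu^{-1}(m)$; $\rho((hm)\alpha(g))=\Delta(\alpha(h))(\rho(m)\Delta(g))$, $\sigma((hm)\alpha(g))=\Delta(\alpha(h))(\sigma(m)\Delta(g))$; and $m_{(-1)}\otimes(m_{(0)[0]}\otimes m_{(0)[1]})=\alpha(m_{[0](-1)})\otimes(m_{[0](0)}\otimes\alpha^{-1}(m_{[1]}))$. Morphisms are the $k$-linear maps that commute with the automorphisms and are $H$-linear and $H$-colinear on both sides. Put $P_L(m)=S(m_{(-1)})m_{(0)}$ and $P_R(m)=m_{[0]}S(m_{[1]})$. For $(M,\mu)$, $(N,\nu)$ let $M\otimes_HN$ be the quotient of $M\otimes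 N$ by the relations $mh\otimes n=\mu(m)\otimes h\nu^{-1}(n)$, with automorphism $\mu\otimes_H\nu$, actions $h(m\otimes_Hn)=\alpha^{-1}(h)m\otimes_H\nu(n)$ and $(m\otimes_Hn)h=\mu(m)\otimes_Hn\alpha^{-1}(h)$, and coactions $m\otimes_Hn\mapsto m_{(-1)}n_{(-1)}\otimes(m_{(0)}\otimes_Hn_{(0)})$ and $m\otimes_Hn\mapsto(m_{[0]}\otimes_Hn_{[0]})\otimes m_{[1]}n_{[1]}$. **Theorem.** Let $(H,\alpha)$ be a monoidal Hom-Hopf algebra over a commutative ring $k$. The category of bicovariant $(H,\alpha)$-Hom-bimodules is a monoidal category with the tensor product $\otimes_H$ above (on morphisms, $(f\otimes_H g)(m\otimes_H n)=f(m)\otimes_H g(n)$), the associativity constraint $$\tilde a_{M,N,P}((m\otimes_Hn)\otimes_Hp)=\mu(m)\otimes_H(n\otimes_H\pi^{-1}(p))$$ (where $\pi$ is the automorphism of $P$), the unit object $(H,\alpha)$ (with product as both actions and coproduct as both coactions), and the unit constraints $h\otimes_Hm\mapsto hm$ and $m\otimes_Hh\mapsto mh$. It is prebraided: the formula $$c_{M,N}(m\otimes_Hn)=m_{(-1)}P_R(n_{[0]})\otimes_HP_L(m_{(0)})n_{[1]}$$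 gives well-defined morphisms $c_{M,N}:M\otimes_HN\to N\otimes_HM$ of bicovariant Hom-bimodules that are natural in $M$ and $N$, satisfy both hexagon axioms and are compatible with the unit constraints. If the antipode of $H$ is bijective, every $c_{M,N}$ is an isomorphism, so that the category is a braided monoidal category with braiding $c$. -/

import Mathlib

open CategoryTheory MonoidalCategory TensorProduct

universe u v

/-! ### Monoidal Hom-Hopf algebras

A Hom-object over `k` is a `k`-module with a `k`-linear automorphism (`α`, `γ`, `μ` below).
Products and actions are bilinear maps, coproducts and coactions are linear maps into the tensor
product over `k`. -/

/-- Monoidal Hom-algebra `(A, α)`. -/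
structure MonoidalHomAlgebra (k : Type u) (A : Type v) [CommRing k] [AddCommGroup A]
    [Module k A] where
  α : A ≃ₗ[k] A
  mul : A →ₗ[k] A →ₗ[k] A
  one : A
  α_mul : ∀ a b, α (mul a b) = mul (α a) (α b)
  α_one : α one = one
  hom_assoc : ∀ a b c, mul (α a) (mul b c) = mul (mul a b) (α c)
  mul_one : ∀ a, mul a one = α a
  one_mul : ∀ a, mul one a = α a

/-- Monoidal Hom-coalgebra `(C, α)`. -/
structure MonoidalHomCoalgebra (k : Type u) (C : Type v) [CommRing k] [AddCommGroup C]
    [Module k C] where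
  α : C ≃ₗ[k] C
  comul : C →ₗ[k] C ⊗[k] C
  counit : C →ₗ[k] k
  comul_α : ∀ c, comul (α c) = TensorProduct.map α.toLinearMap α.toLinearMap (comul c)
  counit_α : ∀ c, counit (α c) = counit c
  /-- `α⁻¹(c₁) ⊗ Δ(c₂) = c₁₁ ⊗ (c₁₂ ⊗ α⁻¹(c₂))` -/
  hom_coassoc : ∀ c, TensorProduct.map α.symm.toLinearMap comul (comul c) =
    TensorProduct.assoc k C C C (TensorProduct.map comul α.symm.toLinearMap (comul c))
  /-- `c₁ ε(c₂) = α⁻¹(c)` -/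
  comul_counit : ∀ c, TensorProduct.rid k C (counit.lTensor C (comul c)) = α.symm c
  /-- `ε(c₁) c₂ = α⁻¹(c)` -/
  counit_comul : ∀ c, TensorProduct.lid k C (counit.rTensor C (comul c)) = α.symm c

/-- Monoidal Hom-bialgebra; the automorphism `α` is shared by the two structures. -/
structure MonoidalHomBialgebra (k : Type u) (H : Type v) [CommRing k] [AddCommGroup H]
    [Module k H] extends MonoidalHomAlgebra k H, MonoidalHomCoalgebra k H where
  /-- `Δ(gh) = Δ(g)Δ(h)`, with the componentwise product on `H ⊗ H`. -/
  comul_mul : ∀ g h, comul (mul g h) = TensorProduct.map₂ mul mul (comul g) (comul h)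
  comul_one : comul one = one ⊗ₜ[k] one
  counit_mul : ∀ g h, counit (mul g h) = counit g * counit h
  counit_one : counit one = 1

/-- Monoidal Hom-Hopf algebra. -/
structure MonoidalHomHopfAlgebra (k : Type u) (H : Type v) [CommRing k] [AddCommGroup H]
    [Module k H] extends MonoidalHomBialgebra k H where
  antipode : H →ₗ[k] H
  antipode_α : ∀ h, antipode (α h) = α (antipode h)
  /-- `S(h₁) h₂ = ε(h) 1` -/
  antipode_mul : ∀ h, TensorProduct.lift mul (antipode.rTensor H (comul h)) = counit h • one
  /-- `h₁ S(h₂) = ε(h) 1` -/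
  mul_antipode : ∀ h, TensorProduct.lift mul (antipode.lTensor H (comul h)) = counit h • one

/-! ### Bicovariant Hom-bimodules -/

section Bimodules

variable {k : Type u} {H : Type v} [CommRing k] [AddCommGroup H] [Module k H]

/-- `(H, α)`-Hom-bimodule structure on a `k`-module `M`, with `lact h m = hm`, `ract m h = mh`. -/
structure HomBimodule (𝓗 : MonoidalHomHopfAlgebra k H) (M : Type v) [AddCommGroup M]
    [Module k M] where
  μ : M ≃ₗ[k] M
  lact : H →ₗ[k] M →ₗ[k] M
  ract : M →ₗ[k] H →ₗ[k] M
  μ_lact : ∀ h m, μ (lact h m) = lact (𝓗.α h) (μ m)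
  μ_ract : ∀ m h, μ (ract m h) = ract (μ m) (𝓗.α h)
  lact_lact : ∀ g h m, lact (𝓗.α g) (lact h m) = lact (𝓗.mul g h) (μ m)
  one_lact : ∀ m, lact 𝓗.one m = μ m
  ract_ract : ∀ m g h, ract (ract m g) (𝓗.α h) = ract (μ m) (𝓗.mul g h)
  ract_one : ∀ m, ract m 𝓗.one = μ m
  lact_ract : ∀ g m h, ract (lact g m) (𝓗.α h) = lact (𝓗.α g) (ract m h)

/-- Left-covariant Hom-bimodule, with left coaction `ρ(m) = m₍₋₁₎ ⊗ m₍₀₎`. -/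
structure LeftCovariantHomBimodule (𝓗 : MonoidalHomHopfAlgebra k H) (M : Type v)
    [AddCommGroup M] [Module k M] extends HomBimodule 𝓗 M where
  ρ : M →ₗ[k] H ⊗[k] M
  ρ_μ : ∀ m, ρ (μ m) = TensorProduct.map 𝓗.α.toLinearMap μ.toLinearMap (ρ m)
  /-- `α⁻¹(m₍₋₁₎) ⊗ ρ(m₍₀₎) = m₍₋₁₎₁ ⊗ (m₍₋₁₎₂ ⊗ μ⁻¹(m₍₀₎))` -/
  ρ_coassoc : ∀ m, TensorProduct.map 𝓗.α.symm.toLinearMap ρ (ρ m) =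
    TensorProduct.assoc k H H M (TensorProduct.map 𝓗.comul μ.symm.toLinearMap (ρ m))
  /-- `ε(m₍₋₁₎) m₍₀₎ = μ⁻¹(m)` -/
  ρ_counit : ∀ m, TensorProduct.lid k M (𝓗.counit.rTensor M (ρ m)) = μ.symm m
  /-- `ρ((hm)α(g)) = Δ(α(h))(ρ(m)Δ(g))` -/
  ρ_covariant : ∀ h m g, ρ (ract (lact h m) (𝓗.α g)) =
    TensorProduct.map₂ 𝓗.mul lact (𝓗.comul (𝓗.α h))
      (TensorProduct.map₂ 𝓗.mul ract (ρ m) (𝓗.comul g))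

/-- Right-covariant Hom-bimodule, with right coaction `σ(m) = m_[0] ⊗ m_[1]`. -/
structure RightCovariantHomBimodule (𝓗 : MonoidalHomHopfAlgebra k H) (M : Type v)
    [AddCommGroup M] [Module k M] extends HomBimodule 𝓗 M where
  σ : M →ₗ[k] M ⊗[k] H
  σ_μ : ∀ m, σ (μ m) = TensorProduct.map μ.toLinearMap 𝓗.α.toLinearMap (σ m)
  /-- `μ⁻¹(m_[0]) ⊗ Δ(m_[1]) = m_[0][0] ⊗ (m_[0][1] ⊗ α⁻¹(m_[1]))` -/
  σ_coassoc : ∀ m, TensorProduct.map μ.symm.toLinearMap 𝓗.comul (σ m) =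
    TensorProduct.assoc k M H H (TensorProduct.map σ 𝓗.α.symm.toLinearMap (σ m))
  /-- `m_[0] ε(m_[1]) = μ⁻¹(m)` -/
  σ_counit : ∀ m, TensorProduct.rid k M (𝓗.counit.lTensor M (σ m)) = μ.symm m
  /-- `σ((hm)α(g)) = Δ(α(h))(σ(m)Δ(g))` -/
  σ_covariant : ∀ h m g, σ (ract (lact h m) (𝓗.α g)) =
    TensorProduct.map₂ lact 𝓗.mul (𝓗.comul (𝓗.α h))
      (TensorProduct.map₂ ract 𝓗.mul (σ m) (𝓗.comul g))

/-- Bicovariant Hom-bimodule structure on `M`. -/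
structure BicovariantStructure (𝓗 : MonoidalHomHopfAlgebra k H) (M : Type v)
    [AddCommGroup M] [Module k M] extends
    LeftCovariantHomBimodule 𝓗 M, RightCovariantHomBimodule 𝓗 M where
  /-- `m₍₋₁₎ ⊗ (m₍₀₎_[0] ⊗ m₍₀₎_[1]) = α(m_[0]₍₋₁₎) ⊗ (m_[0]₍₀₎ ⊗ α⁻¹(m_[1]))` -/
  hom_comm : ∀ m, σ.lTensor H (ρ m) =
    TensorProduct.map 𝓗.α.toLinearMap (TensorProduct.map LinearMap.id 𝓗.α.symm.toLinearMap)
      (TensorProduct.assoc k H M H (ρ.rTensor H (σ m)))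

/-- The objects of the category of bicovariant `(H, α)`-Hom-bimodules. -/
structure BicovariantHomBimodule (𝓗 : MonoidalHomHopfAlgebra k H) where
  carrier : Type v
  [addCommGroup : AddCommGroup carrier]
  [module : Module k carrier]
  str : BicovariantStructure 𝓗 carrier

attribute [instance] BicovariantHomBimodule.addCommGroup BicovariantHomBimodule.module

namespace BicovariantHomBimodule

variable {𝓗 : MonoidalHomHopfAlgebra k H}

instance : CoeSort (BicovariantHomBimodule 𝓗) (Type v) := ⟨carrier⟩

/-- Morphisms: `k`-linear maps commuting with the automorphisms that are linear and colinear over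
`H` on both sides. -/
@[ext]
structure Hom (M N : BicovariantHomBimodule 𝓗) where
  lin : M →ₗ[k] N
  map_μ : ∀ m, lin (M.str.μ m) = N.str.μ (lin m)
  map_lact : ∀ h m, lin (M.str.lact h m) = N.str.lact h (lin m)
  map_ract : ∀ m h, lin (M.str.ract m h) = N.str.ract (lin m) h
  map_ρ : ∀ m, N.str.ρ (lin m) = lin.lTensor H (M.str.ρ m)
  map_σ : ∀ m, N.str.σ (lin m) = lin.rTensor H (M.str.σ m)

instance : Category (BicovariantHomBimodule 𝓗) where
  Hom := Hom
  id M :=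
    { lin := LinearMap.id
      map_μ := fun _ => rfl
      map_lact := fun _ _ => rfl
      map_ract := fun _ _ => rfl
      map_ρ := fun _ => by simp
      map_σ := fun _ => by simp }
  comp f g :=
    { lin := g.lin ∘ₗ f.lin
      map_μ := fun m => by simp [f.map_μ, g.map_μ]
      map_lact := fun h m => by simp [f.map_lact, g.map_lact]
      map_ract := fun m h => by simp [f.map_ract, g.map_ract]
      map_ρ := fun m => by simp [f.map_ρ, g.map_ρ, LinearMap.lTensor_comp]
      map_σ := fun m => by simp [f.map_σ, g.map_σ, LinearMap.rTensor_comp] }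

/-- `(H, α)` as a bicovariant Hom-bimodule over itself: both actions are the product and both
coactions are the coproduct. -/
def regular (𝓗 : MonoidalHomHopfAlgebra k H) : BicovariantHomBimodule 𝓗 where
  carrier := H
  str :=
    { μ := 𝓗.α
      lact := 𝓗.mul
      ract := 𝓗.mul
      μ_lact := 𝓗.α_mul
      μ_ract := 𝓗.α_mul
      lact_lact := 𝓗.hom_assoc
      one_lact := 𝓗.one_mul
      ract_ract := fun m g h => (𝓗.hom_assoc m g h).symm
      ract_one := 𝓗.mul_one
      lact_ract := fun g m h => (𝓗.hom_assoc g m h).symm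
      ρ := 𝓗.comul
      ρ_μ := 𝓗.comul_α
      ρ_coassoc := 𝓗.hom_coassoc
      ρ_counit := 𝓗.counit_comul
      ρ_covariant := fun h m g => by rw [← 𝓗.hom_assoc, 𝓗.comul_mul, 𝓗.comul_mul]
      σ := 𝓗.comul
      σ_μ := 𝓗.comul_α
      σ_coassoc := 𝓗.hom_coassoc
      σ_counit := 𝓗.comul_counit
      σ_covariant := fun h m g => by rw [← 𝓗.hom_assoc, 𝓗.comul_mul, 𝓗.comul_mul]
      hom_comm := fun m => by
        have key := congrArg (TensorProduct.map 𝓗.α.toLinearMap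
          (LinearMap.id : H ⊗[k] H →ₗ[k] H ⊗[k] H)) (𝓗.hom_coassoc m)
        have e1 : ∀ x : H ⊗[k] H, TensorProduct.map 𝓗.α.toLinearMap LinearMap.id
            (TensorProduct.map 𝓗.α.symm.toLinearMap 𝓗.comul x) = 𝓗.comul.lTensor H x := by
          intro x
          induction x with
          | zero => simp
          | tmul a b => simp
          | add a b ha hb => simp only [map_add, ha, hb]
        have e2 : ∀ x : H ⊗[k] H, TensorProduct.map 𝓗.α.toLinearMap LinearMap.id
            (TensorProduct.assoc k H H H
              (TensorProduct.map 𝓗.comul 𝓗.α.symm.toLinearMap x)) =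
            TensorProduct.map 𝓗.α.toLinearMap
              (TensorProduct.map LinearMap.id 𝓗.α.symm.toLinearMap)
              (TensorProduct.assoc k H H H (𝓗.comul.rTensor H x)) := by
          intro x
          induction x with
          | zero => simp
          | tmul a b =>
            simp only [TensorProduct.map_tmul, LinearMap.rTensor_tmul]
            induction 𝓗.comul a with
            | zero => simp
            | tmul c d => simp
            | add c d hc hd => simp only [TensorProduct.add_tmul, map_add, hc, hd]
          | add a b ha hb => simp only [map_add, ha, hb]
        rw [e1, e2] at key
        exact key }

variable (M N : BicovariantHomBimodule 𝓗)

/-- `P_L(m) = S(m₍₋₁₎) m₍₀₎`. -/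
noncomputable def projL : M →ₗ[k] M :=
  TensorProduct.lift M.str.lact ∘ₗ 𝓗.antipode.rTensor M ∘ₗ M.str.ρ

/-- `P_R(m) = m_[0] S(m_[1])`. -/
noncomputable def projR : M →ₗ[k] M :=
  TensorProduct.lift M.str.ract ∘ₗ 𝓗.antipode.lTensor M ∘ₗ M.str.σ

/-! ### The tensor product over `H` -/

/-- `(m ⊗ h) ⊗ n ↦ mh ⊗ n`. -/
noncomputable def coeqFst : (M ⊗[k] H) ⊗[k] N →ₗ[k] M ⊗[k] N :=
  (TensorProduct.lift M.str.ract).rTensor N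

/-- `(m ⊗ h) ⊗ n ↦ μ(m) ⊗ hν⁻¹(n)`, the twisted associativity constraint
`(m ⊗ h) ⊗ n ↦ μ(m) ⊗ (h ⊗ ν⁻¹(n))` followed by the left action. -/
noncomputable def coeqSnd : (M ⊗[k] H) ⊗[k] N →ₗ[k] M ⊗[k] N :=
  (TensorProduct.lift N.str.lact).lTensor M ∘ₗ
    TensorProduct.map M.str.μ.toLinearMap
      (TensorProduct.map LinearMap.id N.str.μ.symm.toLinearMap) ∘ₗ
    (TensorProduct.assoc k M H N).toLinearMap

/-- `m ⊗ n ↦ m₍₋₁₎n₍₋₁₎ ⊗ (m₍₀₎ ⊗ n₍₀₎)`. -/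
noncomputable def leftCodiag : M ⊗[k] N →ₗ[k] H ⊗[k] (M ⊗[k] N) :=
  (TensorProduct.lift 𝓗.mul).rTensor (M ⊗[k] N) ∘ₗ
    (TensorProduct.tensorTensorTensorComm k H M H N).toLinearMap ∘ₗ
    TensorProduct.map M.str.ρ N.str.ρ

/-- `m ⊗ n ↦ (m_[0] ⊗ n_[0]) ⊗ m_[1]n_[1]`. -/
noncomputable def rightCodiag : M ⊗[k] N →ₗ[k] (M ⊗[k] N) ⊗[k] H :=
  (TensorProduct.lift 𝓗.mul).lTensor (M ⊗[k] N) ∘ₗ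
    (TensorProduct.tensorTensorTensorComm k M H N H).toLinearMap ∘ₗ
    TensorProduct.map M.str.σ N.str.σ

/-- `m ⊗ n ↦ m₍₋₁₎P_R(n_[0]) ⊗ P_L(m₍₀₎)n_[1]`. -/
noncomputable def preBraid : M ⊗[k] N →ₗ[k] N ⊗[k] M :=
  TensorProduct.map (TensorProduct.lift N.str.lact) (TensorProduct.lift M.str.ract) ∘ₗ
    (TensorProduct.tensorTensorTensorComm k H M N H).toLinearMap ∘ₗ
    TensorProduct.map (M.projL.lTensor H) (N.projR.rTensor H) ∘ₗ
    TensorProduct.map M.str.ρ N.str.σ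

variable {M N}

/-- `π : M ⊗ N → P` exhibits the bicovariant Hom-bimodule `P` as `M ⊗_H N`: as a `k`-module, `P`
is the coequalizer of `(m ⊗ h) ⊗ n ↦ mh ⊗ n` and `(m ⊗ h) ⊗ n ↦ μ(m) ⊗ hν⁻¹(n)`, and, writing
`m ⊗_H n = π(m ⊗ n)`, its automorphism, actions and coactions are
`m ⊗_H n ↦ μ(m) ⊗_H ν(n)`, `h(m ⊗_H n) = α⁻¹(h)m ⊗_H ν(n)`, `(m ⊗_H n)h = μ(m) ⊗_H nα⁻¹(h)`,
`m ⊗_H n ↦ m₍₋₁₎n₍₋₁₎ ⊗ (m₍₀₎ ⊗_H n₍₀₎)`, `m ⊗_H n ↦ (m_[0] ⊗_H n_[0]) ⊗ m_[1]n_[1]`. -/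
structure IsTensorOver {P : BicovariantHomBimodule 𝓗} (π : M ⊗[k] N →ₗ[k] P) : Prop where
  surjective : Function.Surjective π
  ker_eq : LinearMap.ker π = LinearMap.range (coeqFst M N - coeqSnd M N)
  μ_eq : ∀ (m : M) (n : N), P.str.μ (π (m ⊗ₜ n)) = π (M.str.μ m ⊗ₜ N.str.μ n)
  lact_eq : ∀ (h : H) (m : M) (n : N),
    P.str.lact h (π (m ⊗ₜ n)) = π (M.str.lact (𝓗.α.symm h) m ⊗ₜ N.str.μ n)
  ract_eq : ∀ (m : M) (n : N) (h : H),
    P.str.ract (π (m ⊗ₜ n)) h = π (M.str.μ m ⊗ₜ N.str.ract n (𝓗.α.symm h))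
  ρ_eq : ∀ x : M ⊗[k] N, P.str.ρ (π x) = π.lTensor H (leftCodiag M N x)
  σ_eq : ∀ x : M ⊗[k] N, P.str.σ (π x) = π.rTensor H (rightCodiag M N x)

end BicovariantHomBimodule

end Bimodules

/-! ### Prebraidings -/

/-- A prebraiding on a monoidal category: a natural family `X ⊗ Y ⟶ Y ⊗ X`, not necessarily
invertible, that satisfies both hexagon axioms and is compatible with the unit constraints
(for an invertible family the latter follows from the former). -/
structure Prebraiding (C : Type u) [Category.{v} C] [MonoidalCategory C] where
  braid : ∀ X Y : C, X ⊗ Y ⟶ Y ⊗ X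
  naturality : ∀ {X X' Y Y' : C} (f : X ⟶ X') (g : Y ⟶ Y'),
    (f ⊗ₘ g) ≫ braid X' Y' = braid X Y ≫ (g ⊗ₘ f)
  hexagon_forward : ∀ X Y Z : C,
    (α_ X Y Z).hom ≫ braid X (Y ⊗ Z) ≫ (α_ Y Z X).hom =
      (braid X Y ▷ Z) ≫ (α_ Y X Z).hom ≫ (Y ◁ braid X Z)
  hexagon_reverse : ∀ X Y Z : C,
    (α_ X Y Z).inv ≫ braid (X ⊗ Y) Z ≫ (α_ Z X Y).inv =
      (X ◁ braid Y Z) ≫ (α_ X Z Y).inv ≫ (braid X Z ▷ Y)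
  braid_unit_left : ∀ X : C, braid (𝟙_ C) X ≫ (ρ_ X).hom = (λ_ X).hom
  braid_unit_right : ∀ X : C, braid X (𝟙_ C) ≫ (λ_ X).hom = (ρ_ X).hom

/-! The Hom-twists can be removed. With the product `α⁻¹(ab)` and the coproduct `Δ(α(h))`, `H`
becomes an ordinary Hopf algebra and `α` respects its structure. With the actions `μ⁻¹(hm)`,
`μ⁻¹(mh)` and the coactions `ρ(μ(m))`, `σ(μ(m))`, a bicovariant Hom-bimodule becomes an ordinary
bicovariant bimodule, and `μ` is a homomorphism along `α`. Conversely, an ordinary bicovariant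
bimodule with such a `μ` can be twisted back. Hence the category is that of ordinary bicovariant
bimodules with a compatible automorphism. Its tensor product is the ordinary one over the untwisted
`H`, and its constraints are the untwisted ones. The twisted formulas reappear through the
projection `m ⊗ n ↦ μ(m) ⊗ ν(n)`, which turns the twisted relations into the ordinary ones.

For ordinary bimodules the key fact is the fundamental theorem of Hopf modules: `m = m₍₋₁₎P_L(m₍₀₎)`
with `P_L(m₍₀₎)` left coinvariant, and symmetrically `n = P_R(n_[0])n_[1]` (`sw_lact_projL`,
`ρ_projL`, `sw_ract_projR`, `σ_projR`). So the bimodule `M ⊗_H N` is generated by the `m ⊗ n` with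
`m` left coinvariant and `n` right coinvariant, and two bimodule maps agree once they agree there
(`eq_of_eq_on_coinvariants`). The map `c` is a bimodule map, and on these generators it is the flip
`m ⊗ n ↦ n ⊗ m` (`braid_mk_of_coinvariant`). Colinearity, both hexagons and the unit axioms thus
reduce to statements about the flip. Besides the flip formula they use that each coaction preserves
the coinvariants of the other, that coinvariants are closed under tensor products, and that the
coinvariants of `H` are multiples of `1`. Naturality is read off from the defining formula.

If the antipode is bijective, its inverse is an antipode for the opposite coproduct. The prebraiding
of the bimodules with exchanged coactions is again a flip, now in the other direction, so it inverts
`c`. -/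

set_option linter.unusedSectionVars false

/-! ### Multilinear calculus with Sweedler sums -/

section Sweedler

/-- The function `f` is `k`-linear; a predicate for use with `fun_prop`. -/
@[fun_prop]
def Lin (k : Type*) {A B : Type*} [CommRing k] [AddCommGroup A] [Module k A] [AddCommGroup B]
    [Module k B] (f : A → B) : Prop := ∃ g : A →ₗ[k] B, ∀ x, f x = g x

variable {k : Type*} [CommRing k]
variable {A B C D E : Type*} [AddCommGroup A] [Module k A] [AddCommGroup B] [Module k B]
  [AddCommGroup C] [Module k C] [AddCommGroup D] [Module k D] [AddCommGroup E] [Module k E]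

namespace Lin

@[fun_prop] theorem id' : Lin k (fun x : A => x) := ⟨LinearMap.id, fun _ => rfl⟩

@[fun_prop] theorem comp' {f : B → C} {g : A → B} (hf : Lin k f) (hg : Lin k g) : Lin k (fun x => f (g x)) := by
  obtain ⟨f', hf⟩ := hf
  obtain ⟨g', hg⟩ := hg
  exact ⟨f' ∘ₗ g', fun x => by simp [hf, hg]⟩

theorem map_add {f : A → B} (hf : Lin k f) (x y : A) : f (x + y) = f x + f y := by
  obtain ⟨f', hf⟩ := hf; simp [hf]

theorem map_smul {f : A → B} (hf : Lin k f) (c : k) (x : A) : f (c • x) = c • f x := by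
  obtain ⟨f', hf⟩ := hf; simp [hf]

theorem mk' {f : A → B} (h1 : ∀ x y, f (x + y) = f x + f y) (h2 : ∀ (c : k) x, f (c • x) = c • f x) :
    Lin k f := ⟨⟨⟨f, h1⟩, h2⟩, fun _ => rfl⟩

@[fun_prop] theorem coe (L : A →ₗ[k] B) {f : C → A} (hf : Lin k f) :
    Lin k (fun x => L (f x)) := comp' ⟨L, fun _ => rfl⟩ hf

@[fun_prop] theorem coe_equiv (L : A ≃ₗ[k] B) {f : C → A} (hf : Lin k f) :
    Lin k (fun x => L (f x)) := comp' ⟨L.toLinearMap, fun _ => rfl⟩ hf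

@[fun_prop] theorem app {L : A → B →ₗ[k] C} (hL : Lin k L) (b : B) :
    Lin k (fun x => L x b) := comp' (f := fun l : B →ₗ[k] C => l b) ⟨LinearMap.applyₗ b, fun _ => rfl⟩ hL

@[fun_prop] theorem tmul_left {f : A → B} (hf : Lin k f) (c : C) : Lin k (fun x => f x ⊗ₜ[k] c) :=
  comp' (f := fun b : B => b ⊗ₜ[k] c) ⟨(TensorProduct.mk k B C).flip c, fun _ => rfl⟩ hf

@[fun_prop] theorem tmul_right {f : A → B} (hf : Lin k f) (c : C) : Lin k (fun x => c ⊗ₜ[k] f x) :=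
  comp' (f := fun b : B => c ⊗ₜ[k] b) ⟨TensorProduct.mk k C B c, fun _ => rfl⟩ hf

@[fun_prop] theorem smul_left {f : A → k} (hf : Lin k f) (c : C) : Lin k (fun x => f x • c) :=
  comp' ⟨LinearMap.toSpanSingleton k C c, fun _ => rfl⟩ hf

@[fun_prop] theorem smul_right {f : A → B} (hf : Lin k f) (c : k) : Lin k (fun x => c • f x) :=
  comp' ⟨LinearMap.lsmul k B c, fun _ => rfl⟩ hf

end Lin

/-- A finite family of pairs with `∑ a ⊗ b = x`. -/
noncomputable def tensorRep (x : A ⊗[k] B) : Multiset (A × B) :=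
  (TensorProduct.exists_multiset x).choose

/-- Sweedler sum: `sw x f = ∑ f a b` for a chosen decomposition `x = ∑ a ⊗ b`. -/
noncomputable def sw (x : A ⊗[k] B) (f : A → B → C) : C :=
  ((tensorRep x).map fun p => f p.1 p.2).sum

theorem sw_tmul_self (x : A ⊗[k] B) : sw x (fun a b => a ⊗ₜ[k] b) = x :=
  (TensorProduct.exists_multiset x).choose_spec.symm

/-- This makes the chosen decomposition harmless: for a bilinear summand the sum depends only on the
tensor. For other summands it may depend on the choice, hence the linearity side conditions below.
-/
theorem sw_eq_lift (x : A ⊗[k] B) (F : A →ₗ[k] B →ₗ[k] C) :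
    sw x (fun a b => F a b) = TensorProduct.lift F x := by
  conv_rhs => rw [← sw_tmul_self x]
  simp [sw, map_multiset_sum, Function.comp_def]

theorem map_sw {F : Type*} [FunLike F C D] [AddMonoidHomClass F C D] (L : F) (x : A ⊗[k] B)
    (f : A → B → C) : L (sw x f) = sw x (fun a b => L (f a b)) := by
  simp [sw, map_multiset_sum]

/-- Only finite sums are interchanged, so no linearity of the summand is needed. -/
theorem sw_comm {A' B' : Type*} [AddCommGroup A'] [Module k A'] [AddCommGroup B'] [Module k B']
    (x : A ⊗[k] B) (y : A' ⊗[k] B') (f : A → B → A' → B' → C) :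
    sw x (fun a b => sw y (fun c d => f a b c d)) = sw y (fun c d => sw x (fun a b => f a b c d)) := by
  simp only [sw]
  exact Multiset.sum_map_sum_map _ _

theorem exists_lift_of_bilin {f : A → B → C} (h1 : ∀ b, Lin k (fun a => f a b))
    (h2 : ∀ a, Lin k (fun b => f a b)) : ∃ F : A →ₗ[k] B →ₗ[k] C, f = fun a b => F a b :=
  ⟨LinearMap.mk₂ k f (fun a a' b => (h1 b).map_add a a') (fun c a b => (h1 b).map_smul c a)
    (fun a b b' => (h2 a).map_add b b') (fun c a b => (h2 a).map_smul c b), rfl⟩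

theorem Lin.sw_left {x : D → A ⊗[k] B} (hx : Lin k x) {f : A → B → C}
    (h1 : ∀ b, Lin k (fun a => f a b)) (h2 : ∀ a, Lin k (fun b => f a b)) :
    Lin k (fun d => sw (x d) f) := by
  obtain ⟨F, rfl⟩ := exists_lift_of_bilin h1 h2
  simp only [sw_eq_lift]
  fun_prop

attribute [fun_prop] Lin.sw_left

@[fun_prop] theorem Lin.sw_right (x : A ⊗[k] B) {f : D → A → B → C}
    (h : ∀ a b, Lin k (fun d => f d a b)) : Lin k (fun d => sw x (f d)) :=
  Lin.mk' (fun d e => by simp [sw, (h _ _).map_add, Multiset.sum_map_add])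
    (fun c d => by simp [sw, (h _ _).map_smul, Multiset.smul_sum])

theorem sw_tmul {f : A → B → C} (a : A) (b : B) (h1 : ∀ b, Lin k (fun a => f a b))
    (h2 : ∀ a, Lin k (fun b => f a b)) : sw (a ⊗ₜ[k] b) f = f a b := by
  obtain ⟨F, rfl⟩ := exists_lift_of_bilin h1 h2
  simp [sw_eq_lift]

/-- The decomposition chosen for the total tensor has nothing to do with those of its terms;
bilinearity of `f` bridges the two. -/
theorem sw_sw {A' B' : Type*} [AddCommGroup A'] [Module k A'] [AddCommGroup B'] [Module k B']
    {f : A → B → C} (x : A' ⊗[k] B') (g : A' → B' → A ⊗[k] B) (h1 : ∀ b, Lin k (fun a => f a b))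
    (h2 : ∀ a, Lin k (fun b => f a b)) : sw (sw x g) f = sw x (fun a b => sw (g a b) f) := by
  obtain ⟨F, rfl⟩ := exists_lift_of_bilin h1 h2
  simp only [sw_eq_lift, map_sw]

theorem comm_eq_sw (x : A ⊗[k] B) : TensorProduct.comm k A B x = sw x fun a b => b ⊗ₜ[k] a := by
  conv_lhs => rw [← sw_tmul_self x]
  simp only [map_sw, TensorProduct.comm_tmul]

theorem map_eq_sw (f : A →ₗ[k] C) (g : B →ₗ[k] D) (x : A ⊗[k] B) :
    TensorProduct.map f g x = sw x fun a b => f a ⊗ₜ[k] g b := by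
  conv_lhs => rw [← sw_tmul_self x]
  simp only [map_sw, TensorProduct.map_tmul]

theorem rTensor_eq_sw (f : A →ₗ[k] C) (x : A ⊗[k] B) :
    f.rTensor B x = sw x fun a b => f a ⊗ₜ[k] b :=
  map_eq_sw f LinearMap.id x

theorem lTensor_eq_sw (f : B →ₗ[k] C) (x : A ⊗[k] B) :
    f.lTensor A x = sw x fun a b => a ⊗ₜ[k] f b :=
  map_eq_sw LinearMap.id f x

theorem tmul_sw (c : D) (x : A ⊗[k] B) (f : A → B → C) :
    c ⊗ₜ[k] sw x f = sw x fun a b => c ⊗ₜ[k] f a b :=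
  map_sw (TensorProduct.mk k D C c) x f

theorem sw_tmul_right (c : D) (x : A ⊗[k] B) (f : A → B → C) :
    sw x f ⊗ₜ[k] c = sw x fun a b => f a b ⊗ₜ[k] c :=
  map_sw ((TensorProduct.mk k C D).flip c) x f

theorem sw_apply (x : A ⊗[k] B) (f : A → B → C →ₗ[k] D) (c : C) :
    sw x f c = sw x fun a b => f a b c :=
  map_sw (LinearMap.applyₗ c : (C →ₗ[k] D) →ₗ[k] D) x f

theorem map₂_eq_sw {A' B' : Type*} [AddCommGroup A'] [Module k A'] [AddCommGroup B'] [Module k B']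
    (f : A →ₗ[k] A' →ₗ[k] C) (g : B →ₗ[k] B' →ₗ[k] D) (x : A ⊗[k] B) (y : A' ⊗[k] B') :
    TensorProduct.map₂ f g x y = sw x fun a b => sw y fun c d => f a c ⊗ₜ[k] g b d := by
  conv_lhs => rw [← sw_tmul_self x, ← sw_tmul_self y]
  simp only [map_sw, sw_apply, TensorProduct.map₂_apply_tmul, TensorProduct.map_tmul]
  rw [sw_comm]

theorem assoc_tmul_eq_sw (x : A ⊗[k] B) (c : C) : TensorProduct.assoc k A B C (x ⊗ₜ[k] c) =
    sw x fun a b => a ⊗ₜ[k] (b ⊗ₜ[k] c) := by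
  conv_lhs => rw [← sw_tmul_self x]
  simp only [map_sw, sw_tmul_right, TensorProduct.assoc_tmul]

/-- The bundled linear map of a linear function. -/
def Lin.toLinearMap {f : A → B} (hf : Lin k f) : A →ₗ[k] B where
  toFun := f
  map_add' := hf.map_add
  map_smul' := hf.map_smul

@[simp] theorem Lin.toLinearMap_apply {f : A → B} (hf : Lin k f) (x : A) :
    hf.toLinearMap x = f x := rfl

/-- The bundled bilinear map of a bilinear function. -/
def mkBilin (f : A → B → C) (h1 : ∀ b, Lin k (fun a => f a b))
    (h2 : ∀ a, Lin k (fun b => f a b)) : A →ₗ[k] B →ₗ[k] C :=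
  LinearMap.mk₂ k f (fun a a' b => (h1 b).map_add a a') (fun c a b => (h1 b).map_smul c a)
    (fun a b b' => (h2 a).map_add b b') (fun c a b => (h2 a).map_smul c b)

@[simp] theorem mkBilin_apply (f : A → B → C) (h1 : ∀ b, Lin k (fun a => f a b))
    (h2 : ∀ a, Lin k (fun b => f a b)) (a : A) (b : B) : mkBilin f h1 h2 a b = f a b := rfl

/-- The bundled trilinear map of a trilinear function. -/
def mkTrilin (f : A → B → C → D) (h1 : ∀ b c, Lin k (fun a => f a b c))
    (h2 : ∀ a c, Lin k (fun b => f a b c)) (h3 : ∀ a b, Lin k (fun c => f a b c)) :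
    A →ₗ[k] B →ₗ[k] C →ₗ[k] D :=
  mkBilin (fun a b => (h3 a b).toLinearMap)
    (fun b => Lin.mk' (fun x y => by ext c; exact (h1 b c).map_add x y)
      (fun r x => by ext c; exact (h1 b c).map_smul r x))
    (fun a => Lin.mk' (fun x y => by ext c; exact (h2 a c).map_add x y)
      (fun r x => by ext c; exact (h2 a c).map_smul r x))

@[simp] theorem mkTrilin_apply (f : A → B → C → D) (h1 : ∀ b c, Lin k (fun a => f a b c))
    (h2 : ∀ a c, Lin k (fun b => f a b c)) (h3 : ∀ a b, Lin k (fun c => f a b c)) (a : A) (b : B)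
    (c : C) : mkTrilin f h1 h2 h3 a b c = f a b c := rfl

theorem smul_sw (c : k) (x : A ⊗[k] B) (f : A → B → C) :
    c • sw x f = sw x fun a b => c • f a b :=
  map_sw (LinearMap.lsmul k C c) x f

end Sweedler

/-! ### Ordinary Hopf algebras, their opposites and co-opposites -/

section Classical

/-- An ordinary Hopf algebra over `k`, with unbundled structure maps. -/
structure HopfStructure (k : Type*) (H : Type*) [CommRing k] [AddCommGroup H] [Module k H] where
  mul : H →ₗ[k] H →ₗ[k] H
  one : H
  comul : H →ₗ[k] H ⊗[k] H
  counit : H →ₗ[k] k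
  antipode : H →ₗ[k] H
  mul_assoc : ∀ a b c, mul (mul a b) c = mul a (mul b c)
  one_mul : ∀ a, mul one a = a
  mul_one : ∀ a, mul a one = a
  coassoc : ∀ h, sw (comul h) (fun a b => sw (comul a) fun c d => c ⊗ₜ[k] (d ⊗ₜ[k] b)) =
    sw (comul h) fun a b => a ⊗ₜ[k] comul b
  counit_comul : ∀ h, (sw (comul h) fun a b => counit a • b) = h
  comul_counit : ∀ h, (sw (comul h) fun a b => counit b • a) = h
  comul_mul : ∀ g h, comul (mul g h) =
    sw (comul g) fun a b => sw (comul h) fun c d => mul a c ⊗ₜ[k] mul b d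
  comul_one : comul one = one ⊗ₜ[k] one
  counit_mul : ∀ g h, counit (mul g h) = counit g * counit h
  counit_one : counit one = 1
  antipode_mul : ∀ h, (sw (comul h) fun a b => mul (antipode a) b) = counit h • one
  mul_antipode : ∀ h, (sw (comul h) fun a b => mul a (antipode b)) = counit h • one

variable {k H : Type*} [CommRing k] [AddCommGroup H] [Module k H]
variable {M N B C : Type*} [AddCommGroup M] [Module k M] [AddCommGroup N] [Module k N]
  [AddCommGroup B] [Module k B] [AddCommGroup C] [Module k C]

/-- Applying a bilinear function to two expressions of the same tensor. -/
theorem sw_congr_of_eq {A : Type*} [AddCommGroup A] [Module k A] {x y : A ⊗[k] B} (h : x = y)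
    (F : A → B → C) : sw x F = sw y F := by rw [h]

namespace HopfStructure

variable (A : HopfStructure k H)

/-- A trilinear function is applied to both sides of coassociativity. This and the analogous rules
below are the rewriting steps of Sweedler notation. -/
theorem sw_coassoc (h : H) (F : H → H → H → C) (h1 : ∀ b c, Lin k fun a => F a b c)
    (h2 : ∀ a c, Lin k fun b => F a b c) (h3 : ∀ a b, Lin k fun c => F a b c) :
    sw (A.comul h) (fun a b => sw (A.comul a) fun c d => F c d b) =
      sw (A.comul h) (fun a b => sw (A.comul b) fun c d => F a c d) := by
  have := sw_congr_of_eq (A.coassoc h) (fun a u => sw u fun b c => F a b c)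
  simpa (disch := fun_prop) only [sw_sw, sw_tmul] using this

theorem sw_comul_mul (g h : H) (F : H → H → C) (h1 : ∀ b, Lin k fun a => F a b)
    (h2 : ∀ a, Lin k fun b => F a b) :
    sw (A.comul (A.mul g h)) F =
      sw (A.comul g) fun a b => sw (A.comul h) fun c d => F (A.mul a c) (A.mul b d) := by
  simp (disch := fun_prop) only [A.comul_mul, sw_sw, sw_tmul]

theorem sw_counit_comul (h : H) (F : H → C) (hF : Lin k F) :
    (sw (A.comul h) fun a b => A.counit a • F b) = F h := by
  obtain ⟨F, hF⟩ := hF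
  simp only [hF]
  conv_rhs => rw [← A.counit_comul h]
  simp only [map_sw, map_smul]

theorem sw_comul_counit (h : H) (F : H → C) (hF : Lin k F) :
    (sw (A.comul h) fun a b => A.counit b • F a) = F h := by
  obtain ⟨F, hF⟩ := hF
  simp only [hF]
  conv_rhs => rw [← A.comul_counit h]
  simp only [map_sw, map_smul]

theorem sw_antipode_mul (h : H) (F : H → C) (hF : Lin k F) :
    (sw (A.comul h) fun a b => F (A.mul (A.antipode a) b)) = A.counit h • F A.one := by
  obtain ⟨F, hF⟩ := hF
  simp only [hF]
  rw [← map_smul, ← A.antipode_mul h, map_sw]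

theorem sw_mul_antipode (h : H) (F : H → C) (hF : Lin k F) :
    (sw (A.comul h) fun a b => F (A.mul a (A.antipode b))) = A.counit h • F A.one := by
  obtain ⟨F, hF⟩ := hF
  simp only [hF]
  rw [← map_smul, ← A.mul_antipode h, map_sw]

theorem sw_comul_one (F : H → H → C) (h1 : ∀ b, Lin k fun a => F a b)
    (h2 : ∀ a, Lin k fun b => F a b) : sw (A.comul A.one) F = F A.one A.one := by
  rw [A.comul_one, sw_tmul _ _ h1 h2]

theorem antipode_one : A.antipode A.one = A.one := by
  have := A.antipode_mul A.one
  rw [A.sw_comul_one _ (by fun_prop) (by fun_prop), A.mul_one, A.counit_one, one_smul] at this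
  exact this

/-- Uniqueness of convolution inverses: both sides invert the product map on `H ⊗ H`. Concretely,
`S(g₁h₁) g₂h₂ S(h₃)S(g₃)` is evaluated by contracting its right part or its left part. The result is
needed to show that an inverse of the antipode is an antipode for the opposite coproduct. -/
theorem antipode_mul_antidistrib (g h : H) :
    A.antipode (A.mul g h) = A.mul (A.antipode h) (A.antipode g) := by
  -- First evaluation: `h₂S(h₃)` and then `g₂S(g₃)` contract to counits, leaving `S(gh)`.
  have key : (sw (A.comul g) fun a b => sw (A.comul h) fun c d => sw (A.comul b) fun b1 b2 =>
      sw (A.comul d) fun d1 d2 => A.mul (A.antipode (A.mul a c)) (A.mul (A.mul b1 d1)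
        (A.mul (A.antipode d2) (A.antipode b2)))) = A.antipode (A.mul g h) := by
    have e : ∀ a b c d, (sw (A.comul b) fun b1 b2 => sw (A.comul d) fun d1 d2 =>
        A.mul (A.antipode (A.mul a c)) (A.mul (A.mul b1 d1)
          (A.mul (A.antipode d2) (A.antipode b2)))) =
        A.counit b • A.counit d • A.antipode (A.mul a c) := by
      intro a b c d
      have e1 : ∀ b1 b2, (sw (A.comul d) fun d1 d2 => A.mul (A.antipode (A.mul a c))
          (A.mul (A.mul b1 d1) (A.mul (A.antipode d2) (A.antipode b2)))) =
          A.counit d • A.mul (A.antipode (A.mul a c)) (A.mul b1 (A.antipode b2)) := by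
        intro b1 b2
        have := A.sw_mul_antipode d (fun x => A.mul (A.antipode (A.mul a c))
          (A.mul b1 (A.mul x (A.antipode b2)))) (by fun_prop)
        simpa only [A.mul_assoc, A.one_mul] using this
      simp only [e1]
      have := A.sw_mul_antipode b (fun x => A.counit d • A.mul (A.antipode (A.mul a c)) x)
        (by fun_prop)
      simpa only [A.mul_one] using this
    simp only [e]
    rw [sw_comm]
    simp (disch := fun_prop) only [A.sw_comul_counit]
  rw [← key]
  -- Coassociativity, here for `h` and in `e3` for `g`, regroups the first two factors. They then
  -- form `S(x₁)x₂` with `x` a product, and only `S(h)S(g)` remains.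
  have e2 : ∀ a b, (sw (A.comul h) fun c d => sw (A.comul b) fun b1 b2 =>
      sw (A.comul d) fun d1 d2 => A.mul (A.antipode (A.mul a c)) (A.mul (A.mul b1 d1)
        (A.mul (A.antipode d2) (A.antipode b2)))) = (sw (A.comul b) fun b1 b2 =>
      sw (A.comul h) fun c d => sw (A.comul c) fun c1 c2 => A.mul (A.antipode (A.mul a c1))
        (A.mul (A.mul b1 c2) (A.mul (A.antipode d) (A.antipode b2)))) := by
    intro a b
    rw [sw_comm]
    simp (disch := fun_prop) only [A.sw_coassoc]
  simp only [e2]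
  have e3 := A.sw_coassoc g (fun a b1 b2 => sw (A.comul h) fun c d =>
    sw (A.comul c) fun c1 c2 => A.mul (A.antipode (A.mul a c1))
        (A.mul (A.mul b1 c2) (A.mul (A.antipode d) (A.antipode b2))))
        (by fun_prop) (by fun_prop) (by fun_prop)
  rw [← e3]
  have e4 : ∀ a b c d, (sw (A.comul a) fun a1 a2 => sw (A.comul c) fun c1 c2 =>
      A.mul (A.antipode (A.mul a1 c1)) (A.mul (A.mul a2 c2)
        (A.mul (A.antipode d) (A.antipode b)))) =
      A.counit c • A.counit a • (A.mul (A.antipode d) (A.antipode b)) := by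
    intro a b c d
    rw [smul_comm]
    have := A.sw_antipode_mul (A.mul a c) (fun x => A.mul x (A.mul (A.antipode d) (A.antipode b)))
      (by fun_prop)
    rw [A.sw_comul_mul _ _ _ (by fun_prop) (by fun_prop)] at this
    simpa only [A.mul_assoc, A.one_mul, A.counit_mul, mul_smul] using this
  have e5 : ∀ a b, (sw (A.comul a) fun a1 a2 => sw (A.comul h) fun c d => sw (A.comul c) fun c1 c2 =>
      A.mul (A.antipode (A.mul a1 c1)) (A.mul (A.mul a2 c2)
        (A.mul (A.antipode d) (A.antipode b)))) =
      A.counit a • (A.mul (A.antipode h) (A.antipode b)) := by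
    intro a b
    rw [sw_comm]
    simp only [e4]
    rw [A.sw_counit_comul h (fun d => A.counit a • (A.mul (A.antipode d) (A.antipode b)))
      (by fun_prop)]
  simp only [e5]
  rw [A.sw_counit_comul g (fun b => A.mul (A.antipode h) (A.antipode b)) (by fun_prop)]

/-- The Hopf algebra with opposite product and opposite coproduct. -/
noncomputable def opcop : HopfStructure k H where
  mul := A.mul.flip
  one := A.one
  comul := (TensorProduct.comm k H H).toLinearMap ∘ₗ A.comul
  counit := A.counit
  antipode := A.antipode
  mul_assoc a b c := by simp [A.mul_assoc]
  one_mul a := by simp [A.mul_one]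
  mul_one a := by simp [A.one_mul]
  coassoc h := by
    simp (disch := fun_prop) only [LinearMap.comp_apply, LinearEquiv.coe_coe, comm_eq_sw, sw_sw,
      sw_tmul, tmul_sw]
    rw [A.sw_coassoc h (fun a b c => c ⊗ₜ[k] (b ⊗ₜ[k] a)) (by fun_prop) (by fun_prop) (by fun_prop)]
  counit_comul h := by
    simp (disch := fun_prop) only [LinearMap.comp_apply, LinearEquiv.coe_coe, comm_eq_sw, sw_sw,
      sw_tmul, A.comul_counit]
  comul_counit h := by
    simp (disch := fun_prop) only [LinearMap.comp_apply, LinearEquiv.coe_coe, comm_eq_sw, sw_sw,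
      sw_tmul, A.counit_comul]
  comul_mul g h := by
    simp (disch := fun_prop) only [LinearMap.comp_apply, LinearEquiv.coe_coe, comm_eq_sw, sw_sw,
      sw_tmul, LinearMap.flip_apply, A.comul_mul]
    rw [sw_comm]
  comul_one := by simp [A.comul_one]
  counit_mul g h := by simp [A.counit_mul, mul_comm]
  counit_one := A.counit_one
  antipode_mul h := by
    simp (disch := fun_prop) only [LinearMap.comp_apply, LinearEquiv.coe_coe, comm_eq_sw, sw_sw,
      sw_tmul, LinearMap.flip_apply, A.mul_antipode]
  mul_antipode h := by
    simp (disch := fun_prop) only [LinearMap.comp_apply, LinearEquiv.coe_coe, comm_eq_sw, sw_sw,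
      sw_tmul, LinearMap.flip_apply, A.antipode_mul]

/-- The Hopf algebra with opposite coproduct, for an inverse `T` of the antipode. -/
noncomputable def cop (T : H →ₗ[k] H) (hT : ∀ h, A.antipode (T h) = h)
    (hT' : ∀ h, T (A.antipode h) = h) : HopfStructure k H where
  mul := A.mul
  one := A.one
  comul := (TensorProduct.comm k H H).toLinearMap ∘ₗ A.comul
  counit := A.counit
  antipode := T
  mul_assoc := A.mul_assoc
  one_mul := A.one_mul
  mul_one := A.mul_one
  coassoc := A.opcop.coassoc
  counit_comul := A.opcop.counit_comul
  comul_counit := A.opcop.comul_counit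
  comul_mul g h := by
    simp (disch := fun_prop) only [LinearMap.comp_apply, LinearEquiv.coe_coe, comm_eq_sw, sw_sw,
      sw_tmul, A.comul_mul]
  comul_one := A.opcop.comul_one
  counit_mul := A.counit_mul
  counit_one := A.counit_one
  antipode_mul h := by
    simp (disch := fun_prop) only [LinearMap.comp_apply, LinearEquiv.coe_coe, comm_eq_sw, sw_sw,
      sw_tmul]
    -- The antipode is injective, so it may be applied to both sides. Being antimultiplicative, it
    -- sends `T(h₂)h₁` to `S(h₁)h₂`.
    refine (Function.LeftInverse.injective hT') ?_
    have h1 : A.antipode A.one = A.one := A.antipode_one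
    simp only [map_sw, A.antipode_mul_antidistrib, hT, map_smul, h1, A.antipode_mul]
  mul_antipode h := by
    simp (disch := fun_prop) only [LinearMap.comp_apply, LinearEquiv.coe_coe, comm_eq_sw, sw_sw,
      sw_tmul]
    refine (Function.LeftInverse.injective hT') ?_
    have h1 : A.antipode A.one = A.one := A.antipode_one
    simp only [map_sw, A.antipode_mul_antidistrib, hT, map_smul, h1, A.mul_antipode]

end HopfStructure

end Classical

/-! ### Ordinary bicovariant bimodules and the projections onto coinvariants -/

section ClassicalBimodules

variable {k H : Type*} [CommRing k] [AddCommGroup H] [Module k H]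
variable {M N B C : Type*} [AddCommGroup M] [Module k M] [AddCommGroup N] [Module k N]
  [AddCommGroup B] [Module k B] [AddCommGroup C] [Module k C]

/-- A bicovariant bimodule over an ordinary Hopf algebra. -/
structure HopfBimodule (A : HopfStructure k H) (M : Type*) [AddCommGroup M] [Module k M] where
  lact : H →ₗ[k] M →ₗ[k] M
  ract : M →ₗ[k] H →ₗ[k] M
  ρ : M →ₗ[k] H ⊗[k] M
  σ : M →ₗ[k] M ⊗[k] H
  mul_lact : ∀ g h m, lact (A.mul g h) m = lact g (lact h m)
  one_lact : ∀ m, lact A.one m = m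
  ract_mul : ∀ m g h, ract m (A.mul g h) = ract (ract m g) h
  ract_one : ∀ m, ract m A.one = m
  lact_ract : ∀ g m h, ract (lact g m) h = lact g (ract m h)
  ρ_coassoc : ∀ m, sw (ρ m) (fun a n => sw (A.comul a) fun c d => c ⊗ₜ[k] (d ⊗ₜ[k] n)) =
    sw (ρ m) fun a n => a ⊗ₜ[k] ρ n
  ρ_counit : ∀ m, (sw (ρ m) fun a n => A.counit a • n) = m
  σ_coassoc : ∀ m, sw (σ m) (fun n a => σ n ⊗ₜ[k] a) =
    sw (σ m) fun n a => sw (A.comul a) fun c d => (n ⊗ₜ[k] c) ⊗ₜ[k] d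
  σ_counit : ∀ m, (sw (σ m) fun n a => A.counit a • n) = m
  ρ_lact : ∀ h m, ρ (lact h m) =
    sw (A.comul h) fun a b => sw (ρ m) fun c n => A.mul a c ⊗ₜ[k] lact b n
  ρ_ract : ∀ m h, ρ (ract m h) =
    sw (ρ m) fun c n => sw (A.comul h) fun a b => A.mul c a ⊗ₜ[k] ract n b
  σ_lact : ∀ h m, σ (lact h m) =
    sw (A.comul h) fun a b => sw (σ m) fun n c => lact a n ⊗ₜ[k] A.mul b c
  σ_ract : ∀ m h, σ (ract m h) =
    sw (σ m) fun n c => sw (A.comul h) fun a b => ract n a ⊗ₜ[k] A.mul c b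
  ρ_σ : ∀ m, (sw (ρ m) fun a n => a ⊗ₜ[k] σ n) =
    sw (σ m) fun n b => sw (ρ n) fun a p => a ⊗ₜ[k] (p ⊗ₜ[k] b)

namespace HopfBimodule

variable {A : HopfStructure k H} (X : HopfBimodule A M) (Y : HopfBimodule A N)

theorem sw_ρ_coassoc (m : M) (F : H → H → M → C) (h1 : ∀ b c, Lin k fun a => F a b c)
    (h2 : ∀ a c, Lin k fun b => F a b c) (h3 : ∀ a b, Lin k fun c => F a b c) :
    sw (X.ρ m) (fun a n => sw (A.comul a) fun c d => F c d n) =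
      sw (X.ρ m) (fun a n => sw (X.ρ n) fun c d => F a c d) := by
  have := sw_congr_of_eq (X.ρ_coassoc m) (fun a u => sw u fun b c => F a b c)
  simpa (disch := fun_prop) only [sw_sw, sw_tmul] using this

theorem sw_σ_coassoc (m : M) (F : M → H → H → C) (h1 : ∀ b c, Lin k fun a => F a b c)
    (h2 : ∀ a c, Lin k fun b => F a b c) (h3 : ∀ a b, Lin k fun c => F a b c) :
    sw (X.σ m) (fun n a => sw (A.comul a) fun c d => F n c d) =
      sw (X.σ m) (fun n a => sw (X.σ n) fun p c => F p c a) := by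
  have := sw_congr_of_eq (X.σ_coassoc m) (fun u c => sw u fun a b => F a b c)
  simp (disch := fun_prop) only [sw_sw, sw_tmul] at this
  exact this.symm

theorem sw_ρ_counit (m : M) (F : M → C) (hF : Lin k F) :
    (sw (X.ρ m) fun a n => A.counit a • F n) = F m := by
  obtain ⟨F, hF⟩ := hF
  simp only [hF]
  conv_rhs => rw [← X.ρ_counit m]
  simp only [map_sw, map_smul]

theorem sw_σ_counit (m : M) (F : M → C) (hF : Lin k F) :
    (sw (X.σ m) fun n a => A.counit a • F n) = F m := by
  obtain ⟨F, hF⟩ := hF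
  simp only [hF]
  conv_rhs => rw [← X.σ_counit m]
  simp only [map_sw, map_smul]

theorem sw_ρ_lact (h : H) (m : M) (F : H → M → C) (h1 : ∀ b, Lin k fun a => F a b)
    (h2 : ∀ a, Lin k fun b => F a b) : sw (X.ρ (X.lact h m)) F =
      sw (A.comul h) fun a b => sw (X.ρ m) fun c n => F (A.mul a c) (X.lact b n) := by
  simp (disch := fun_prop) only [X.ρ_lact, sw_sw, sw_tmul]

theorem sw_ρ_ract (m : M) (h : H) (F : H → M → C) (h1 : ∀ b, Lin k fun a => F a b)
    (h2 : ∀ a, Lin k fun b => F a b) : sw (X.ρ (X.ract m h)) F =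
      sw (X.ρ m) fun c n => sw (A.comul h) fun a b => F (A.mul c a) (X.ract n b) := by
  simp (disch := fun_prop) only [X.ρ_ract, sw_sw, sw_tmul]

theorem sw_σ_lact (h : H) (m : M) (F : M → H → C) (h1 : ∀ b, Lin k fun a => F a b)
    (h2 : ∀ a, Lin k fun b => F a b) : sw (X.σ (X.lact h m)) F =
      sw (A.comul h) fun a b => sw (X.σ m) fun n c => F (X.lact a n) (A.mul b c) := by
  simp (disch := fun_prop) only [X.σ_lact, sw_sw, sw_tmul]

theorem sw_σ_ract (m : M) (h : H) (F : M → H → C) (h1 : ∀ b, Lin k fun a => F a b)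
    (h2 : ∀ a, Lin k fun b => F a b) : sw (X.σ (X.ract m h)) F =
      sw (X.σ m) fun n c => sw (A.comul h) fun a b => F (X.ract n a) (A.mul c b) := by
  simp (disch := fun_prop) only [X.σ_ract, sw_sw, sw_tmul]

theorem sw_ρ_σ (m : M) (F : H → M → H → C) (h1 : ∀ b c, Lin k fun a => F a b c)
    (h2 : ∀ a c, Lin k fun b => F a b c) (h3 : ∀ a b, Lin k fun c => F a b c) :
    sw (X.ρ m) (fun a n => sw (X.σ n) fun p b => F a p b) =
      sw (X.σ m) (fun n b => sw (X.ρ n) fun a p => F a p b) := by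
  have := sw_congr_of_eq (X.ρ_σ m) (fun a u => sw u fun b c => F a b c)
  simpa (disch := fun_prop) only [sw_sw, sw_tmul] using this

/-- The bimodule with the two sides exchanged. -/
noncomputable def opcop : HopfBimodule A.opcop M where
  lact := X.ract.flip
  ract := X.lact.flip
  ρ := (TensorProduct.comm k M H).toLinearMap ∘ₗ X.σ
  σ := (TensorProduct.comm k H M).toLinearMap ∘ₗ X.ρ
  mul_lact g h m := by simp [HopfStructure.opcop, X.ract_mul]
  one_lact := X.ract_one
  ract_mul m g h := by simp [HopfStructure.opcop, X.mul_lact]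
  ract_one := X.one_lact
  lact_ract g m h := (X.lact_ract h m g).symm
  ρ_coassoc m := by
    simp (disch := fun_prop) only [HopfStructure.opcop, LinearMap.comp_apply, LinearEquiv.coe_coe,
      comm_eq_sw, sw_sw, sw_tmul, tmul_sw]
    rw [X.sw_σ_coassoc m (fun a b c => c ⊗ₜ[k] (b ⊗ₜ[k] a)) (by fun_prop) (by fun_prop)
      (by fun_prop)]
  ρ_counit m := by
    simp (disch := fun_prop) only [HopfStructure.opcop, LinearMap.comp_apply, LinearEquiv.coe_coe,
      comm_eq_sw, sw_sw, sw_tmul, X.σ_counit]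
  σ_coassoc m := by
    simp (disch := fun_prop) only [HopfStructure.opcop, LinearMap.comp_apply, LinearEquiv.coe_coe,
      comm_eq_sw, sw_sw, sw_tmul, sw_tmul_right]
    rw [X.sw_ρ_coassoc m (fun a b c => (c ⊗ₜ[k] b) ⊗ₜ[k] a) (by fun_prop) (by fun_prop)
      (by fun_prop)]
  σ_counit m := by
    simp (disch := fun_prop) only [HopfStructure.opcop, LinearMap.comp_apply, LinearEquiv.coe_coe,
      comm_eq_sw, sw_sw, sw_tmul, X.ρ_counit]
  ρ_lact h m := by
    simp (disch := fun_prop) only [HopfStructure.opcop, LinearMap.comp_apply, LinearEquiv.coe_coe,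
      comm_eq_sw, sw_sw, sw_tmul, LinearMap.flip_apply, X.σ_ract]
    rw [sw_comm]
  ρ_ract m h := by
    simp (disch := fun_prop) only [HopfStructure.opcop, LinearMap.comp_apply, LinearEquiv.coe_coe,
      comm_eq_sw, sw_sw, sw_tmul, LinearMap.flip_apply, X.σ_lact]
    rw [sw_comm]
  σ_lact h m := by
    simp (disch := fun_prop) only [HopfStructure.opcop, LinearMap.comp_apply, LinearEquiv.coe_coe,
      comm_eq_sw, sw_sw, sw_tmul, LinearMap.flip_apply, X.ρ_ract]
    rw [sw_comm]
  σ_ract m h := by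
    simp (disch := fun_prop) only [HopfStructure.opcop, LinearMap.comp_apply, LinearEquiv.coe_coe,
      comm_eq_sw, sw_sw, sw_tmul, LinearMap.flip_apply, X.ρ_lact]
    rw [sw_comm]
  ρ_σ m := by
    simp (disch := fun_prop) only [LinearMap.comp_apply, LinearEquiv.coe_coe,
      comm_eq_sw, sw_sw, sw_tmul, tmul_sw]
    rw [X.sw_ρ_σ m (fun a p b => b ⊗ₜ[k] (p ⊗ₜ[k] a)) (by fun_prop) (by fun_prop)
      (by fun_prop)]

/-- The bimodule with exchanged coactions, over the co-opposite Hopf algebra. -/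
noncomputable def cop (T : H →ₗ[k] H) (hT : ∀ h, A.antipode (T h) = h)
    (hT' : ∀ h, T (A.antipode h) = h) : HopfBimodule (A.cop T hT hT') M where
  lact := X.lact
  ract := X.ract
  ρ := (TensorProduct.comm k M H).toLinearMap ∘ₗ X.σ
  σ := (TensorProduct.comm k H M).toLinearMap ∘ₗ X.ρ
  mul_lact := X.mul_lact
  one_lact := X.one_lact
  ract_mul := X.ract_mul
  ract_one := X.ract_one
  lact_ract := X.lact_ract
  ρ_coassoc := X.opcop.ρ_coassoc
  ρ_counit := X.opcop.ρ_counit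
  σ_coassoc := X.opcop.σ_coassoc
  σ_counit := X.opcop.σ_counit
  ρ_lact h m := by
    simp (disch := fun_prop) only [HopfStructure.cop, LinearMap.comp_apply, LinearEquiv.coe_coe,
      comm_eq_sw, sw_sw, sw_tmul, X.σ_lact]
  ρ_ract m h := by
    simp (disch := fun_prop) only [HopfStructure.cop, LinearMap.comp_apply, LinearEquiv.coe_coe,
      comm_eq_sw, sw_sw, sw_tmul, X.σ_ract]
  σ_lact h m := by
    simp (disch := fun_prop) only [HopfStructure.cop, LinearMap.comp_apply, LinearEquiv.coe_coe,
      comm_eq_sw, sw_sw, sw_tmul, X.ρ_lact]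
  σ_ract m h := by
    simp (disch := fun_prop) only [HopfStructure.cop, LinearMap.comp_apply, LinearEquiv.coe_coe,
      comm_eq_sw, sw_sw, sw_tmul, X.ρ_ract]
  ρ_σ := X.opcop.ρ_σ

/-- `m ↦ S(m₍₋₁₎) m₍₀₎`. -/
noncomputable def projL : M →ₗ[k] M :=
  TensorProduct.lift X.lact ∘ₗ A.antipode.rTensor M ∘ₗ X.ρ

/-- `m ↦ m_[0] S(m_[1])`. -/
noncomputable def projR : M →ₗ[k] M :=
  TensorProduct.lift X.ract ∘ₗ A.antipode.lTensor M ∘ₗ X.σ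

theorem projL_apply (m : M) : X.projL m = sw (X.ρ m) fun a n => X.lact (A.antipode a) n := by
  conv_lhs => rw [projL, LinearMap.comp_apply, LinearMap.comp_apply, ← sw_tmul_self (X.ρ m)]
  simp only [map_sw, LinearMap.rTensor_tmul, TensorProduct.lift.tmul]

theorem projR_apply (m : M) : X.projR m = sw (X.σ m) fun n a => X.ract n (A.antipode a) := by
  conv_lhs => rw [projR, LinearMap.comp_apply, LinearMap.comp_apply, ← sw_tmul_self (X.σ m)]
  simp only [map_sw, LinearMap.lTensor_tmul, TensorProduct.lift.tmul]

/-- Exchanging the sides turns left projections into right ones, so each statement on `projR` below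
can be read off from one on `projL`. -/
theorem opcop_projL (m : M) : X.opcop.projL m = X.projR m := by
  simp (disch := fun_prop) only [projL_apply, projR_apply, opcop, HopfStructure.opcop, sw_tmul,
    sw_sw, LinearMap.comp_apply, LinearEquiv.coe_coe, comm_eq_sw, LinearMap.flip_apply]

/-- By coassociativity the left side is `m₍₋₁₎₁S(m₍₋₁₎₂)m₍₀₎`, which the antipode and counit axioms
reduce to `m`. Together with `ρ_projL` it says that `M` is generated by its left coinvariants as a
left module. -/
theorem sw_lact_projL (m : M) : (sw (X.ρ m) fun a n => X.lact a (X.projL n)) = m := by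
  simp only [projL_apply, map_sw, ← X.mul_lact]
  rw [← X.sw_ρ_coassoc m (fun a b n => X.lact (A.mul a (A.antipode b)) n) (by fun_prop)
    (by fun_prop) (by fun_prop)]
  have := fun a n => A.sw_mul_antipode a (fun x => X.lact x n) (by fun_prop)
  simp only [this, X.one_lact, X.ρ_counit]

theorem ρ_eq_sw_projL (m : M) : X.ρ m = sw (X.ρ m) fun a n => sw (A.comul a) fun b c =>
    b ⊗ₜ[k] X.lact c (X.projL n) := by
  rw [X.sw_ρ_coassoc m (fun b c n => b ⊗ₜ[k] X.lact c (X.projL n)) (by fun_prop)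
    (by fun_prop) (by fun_prop)]
  simp only [← tmul_sw, sw_lact_projL, sw_tmul_self]

/-- Rewriting `ρ(n)` by `ρ_eq_sw_projL` collects the coaction of `S(m₍₋₁₎)m₍₀₎` into `Δ(S(a₁)a₂)`
acting on `1 ⊗ P_L(n)`. The antipode axiom then applies inside `Δ`, so no formula for `Δ ∘ S` is
needed. -/
theorem ρ_projL (m : M) : X.ρ (X.projL m) = A.one ⊗ₜ[k] X.projL m := by
  conv_lhs => rw [projL_apply]
  rw [map_sw]
  have e1 : ∀ a n, X.ρ (X.lact (A.antipode a) n) = sw (X.ρ n) fun c n =>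
      sw (A.comul (A.mul (A.antipode a) c)) fun b d => b ⊗ₜ[k] X.lact d (X.projL n) := by
    intro a n
    rw [X.ρ_lact]
    conv_lhs => rw [X.ρ_eq_sw_projL n]
    rw [sw_comm]
    simp (disch := fun_prop) only [sw_sw, sw_tmul, A.sw_comul_mul, X.mul_lact]
    refine congrArg (sw (X.ρ n)) (funext₂ fun a b => ?_)
    rw [sw_comm]
  simp only [e1]
  rw [← X.sw_ρ_coassoc m (fun a c n => sw (A.comul (A.mul (A.antipode a) c)) fun b d =>
    b ⊗ₜ[k] X.lact d (X.projL n)) (by fun_prop) (by fun_prop) (by fun_prop)]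
  have := fun a n => A.sw_antipode_mul a (fun x => sw (A.comul x) fun b d =>
    b ⊗ₜ[k] X.lact d (X.projL n)) (by fun_prop)
  simp only [this, A.comul_one]
  simp (disch := fun_prop) only [sw_tmul, X.one_lact]
  rw [X.sw_ρ_counit m (fun n => A.one ⊗ₜ[k] X.projL n) (by fun_prop)]

theorem projL_of_coinvariant {p : M} (hp : X.ρ p = A.one ⊗ₜ[k] p) : X.projL p = p := by
  rw [projL_apply, hp, sw_tmul _ _ (by fun_prop) (by fun_prop), A.antipode_one, X.one_lact]

theorem projL_lact_of_coinvariant {p : M} (hp : X.ρ p = A.one ⊗ₜ[k] p) (h : H) :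
    X.projL (X.lact h p) = A.counit h • p := by
  rw [projL_apply, X.sw_ρ_lact _ _ _ (by fun_prop) (by fun_prop), hp]
  simp (disch := fun_prop) only [sw_tmul, A.mul_one, ← X.mul_lact]
  rw [A.sw_antipode_mul h (fun x => X.lact x p) (by fun_prop), X.one_lact]

theorem projL_ract_of_coinvariant {p : M} (hp : X.ρ p = A.one ⊗ₜ[k] p) (h : H) :
    X.projL (X.ract p h) = sw (A.comul h) fun a b => X.ract (X.lact (A.antipode a) p) b := by
  rw [projL_apply, X.sw_ρ_ract _ _ _ (by fun_prop) (by fun_prop), hp]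
  simp (disch := fun_prop) only [sw_tmul, A.one_mul, ← X.lact_ract]

/-- Since `m = m₍₋₁₎P_L(m₍₀₎)`, it suffices to know `P_L` on multiples of a coinvariant, where the
antipode axiom leaves only the counit. -/
theorem projL_lact (h : H) (m : M) : X.projL (X.lact h m) = A.counit h • X.projL m := by
  conv_lhs => rw [← X.sw_lact_projL m]
  simp only [map_sw, ← X.mul_lact, X.projL_lact_of_coinvariant (X.ρ_projL _), A.counit_mul,
    mul_smul]
  simp only [smul_comm (A.counit h)]
  exact X.sw_ρ_counit m (fun n => A.counit h • X.projL n) (by fun_prop)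

/-- On left coinvariants, right multiplication is thereby turned into the adjoint action `p ↦
S(h₁)ph₂`. This is what makes the braiding formula balanced over `H`. -/
theorem projL_ract (m : M) (h : H) : X.projL (X.ract m h) =
    sw (A.comul h) fun a b => X.ract (X.lact (A.antipode a) (X.projL m)) b := by
  conv_lhs => rw [← X.sw_lact_projL m]
  simp only [map_sw, sw_apply, X.lact_ract, X.projL_lact,
    X.projL_ract_of_coinvariant (X.ρ_projL _)]
  exact X.sw_ρ_counit m (fun n => sw (A.comul h) fun a b => X.lact (A.antipode a)
    (X.ract (X.projL n) b)) (by fun_prop)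

/-- The right coaction preserves left coinvariants: contract the `H`-leg of the left coaction with
`S` in the commutation of the two coactions. On one side `P_L(m)` is coinvariant, on the other `P_L`
appears. Colinearity of the braiding rests on this and on `ρ_projR`. -/
theorem σ_projL (m : M) : X.σ (X.projL m) =
    sw (X.σ (X.projL m)) fun n a => X.projL n ⊗ₜ[k] a := by
  have h1 := X.sw_ρ_σ (X.projL m) (fun a n b => X.lact (A.antipode a) n ⊗ₜ[k] b) (by fun_prop)
    (by fun_prop) (by fun_prop)
  rw [X.ρ_projL] at h1
  simp (disch := fun_prop) only [sw_tmul, A.antipode_one, X.one_lact, sw_tmul_self,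
    ← sw_tmul_right, ← X.projL_apply] at h1
  exact h1

theorem sw_ract_projR (m : M) : (sw (X.σ m) fun n a => X.ract (X.projR n) a) = m := by
  have := X.opcop.sw_lact_projL m
  simp (disch := fun_prop) only [opcop_projL] at this
  simpa (disch := fun_prop) only [opcop, HopfStructure.opcop, sw_tmul,
    sw_sw, LinearMap.comp_apply, LinearEquiv.coe_coe, comm_eq_sw, LinearMap.flip_apply] using this

theorem σ_projR (m : M) : X.σ (X.projR m) = X.projR m ⊗ₜ[k] A.one := by
  have := congrArg (TensorProduct.comm k H M) (X.opcop.ρ_projL m)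
  simp only [opcop_projL] at this
  simpa [opcop, HopfStructure.opcop] using this

theorem projR_of_coinvariant {p : M} (hp : X.σ p = p ⊗ₜ[k] A.one) : X.projR p = p := by
  rw [projR_apply, hp, sw_tmul _ _ (by fun_prop) (by fun_prop), A.antipode_one, X.ract_one]

theorem projR_ract (m : M) (h : H) : X.projR (X.ract m h) = A.counit h • X.projR m := by
  have := X.opcop.projL_lact h m
  simp only [opcop_projL] at this
  exact this

theorem projR_lact (h : H) (m : M) : X.projR (X.lact h m) =
    sw (A.comul h) fun a b => X.lact a (X.ract (X.projR m) (A.antipode b)) := by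
  have := X.opcop.projL_ract m h
  simp only [opcop_projL] at this
  simpa (disch := fun_prop) only [opcop, HopfStructure.opcop, sw_tmul,
    sw_sw, LinearMap.comp_apply, LinearEquiv.coe_coe, comm_eq_sw, LinearMap.flip_apply] using this

theorem ρ_projR (m : M) : X.ρ (X.projR m) =
    sw (X.ρ (X.projR m)) fun a n => a ⊗ₜ[k] X.projR n := by
  have := congrArg (TensorProduct.comm k M H) (X.opcop.σ_projL m)
  simp only [opcop_projL] at this
  simpa (disch := fun_prop) [opcop, comm_eq_sw, sw_tmul, sw_sw, sw_tmul_self] using this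

end HopfBimodule

end ClassicalBimodules

/-! ### Balanced tensor products -/

section BalancedTensor

variable {k H : Type*} [CommRing k] [AddCommGroup H] [Module k H]
variable {M N C : Type*} [AddCommGroup M] [Module k M] [AddCommGroup N] [Module k N]
  [AddCommGroup C] [Module k C]

/-- `(m ⊗ h) ⊗ n ↦ mh ⊗ n - m ⊗ hn`. -/
noncomputable def balancedRel (r : M →ₗ[k] H →ₗ[k] M) (l : H →ₗ[k] N →ₗ[k] N) :
    (M ⊗[k] H) ⊗[k] N →ₗ[k] M ⊗[k] N :=
  (TensorProduct.lift r).rTensor N -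
    (TensorProduct.lift l).lTensor M ∘ₗ (TensorProduct.assoc k M H N).toLinearMap

/-- The quotient of `M ⊗ N` by the relations `mh ⊗ n = m ⊗ hn`. -/
abbrev BalancedTensor (r : M →ₗ[k] H →ₗ[k] M) (l : H →ₗ[k] N →ₗ[k] N) :=
  (M ⊗[k] N) ⧸ LinearMap.range (balancedRel r l)

namespace BalancedTensor

variable {r : M →ₗ[k] H →ₗ[k] M} {l : H →ₗ[k] N →ₗ[k] N}

variable (r l) in
/-- The class of `m ⊗ n`. -/
noncomputable def mk : M →ₗ[k] N →ₗ[k] BalancedTensor r l :=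
  (TensorProduct.mk k M N).compr₂ (LinearMap.range (balancedRel r l)).mkQ

theorem mk_ract (m : M) (h : H) (n : N) : mk r l (r m h) n = mk r l m (l h n) := by
  rw [← sub_eq_zero, mk, LinearMap.compr₂_apply, LinearMap.compr₂_apply, ← map_sub,
    Submodule.mkQ_apply, Submodule.Quotient.mk_eq_zero]
  exact ⟨(m ⊗ₜ h) ⊗ₜ n, by simp [balancedRel]⟩

/-- The linear map induced by a balanced bilinear map. -/
noncomputable def lift (f : M →ₗ[k] N →ₗ[k] C) (hf : ∀ m h n, f (r m h) n = f m (l h n)) :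
    BalancedTensor r l →ₗ[k] C :=
  (LinearMap.range (balancedRel r l)).liftQ (TensorProduct.lift f) <| by
    rw [LinearMap.range_le_ker_iff]
    ext m h n
    simp [balancedRel, hf]

@[simp] theorem lift_mk (f : M →ₗ[k] N →ₗ[k] C) (hf : ∀ m h n, f (r m h) n = f m (l h n)) (m : M)
    (n : N) : lift f hf (mk r l m n) = f m n := by
  simp [lift, mk]

theorem hom_ext {f g : BalancedTensor r l →ₗ[k] C} (h : ∀ m n, f (mk r l m n) = g (mk r l m n)) :
    f = g := by
  ext m n
  exact h m n

theorem ext_lin {f g : BalancedTensor r l → C} (hf : Lin k f) (hg : Lin k g)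
    (h : ∀ m n, f (mk r l m n) = g (mk r l m n)) (x : BalancedTensor r l) : f x = g x := by
  obtain ⟨f, hf⟩ := hf
  obtain ⟨g, hg⟩ := hg
  simp only [hf, hg] at h ⊢
  rw [hom_ext h]

end BalancedTensor

end BalancedTensor

/-! ### The tensor product over `H` of ordinary bicovariant bimodules -/

namespace HopfBimodule

open BalancedTensor (mk mk_ract)

variable {k H : Type*} [CommRing k] [AddCommGroup H] [Module k H]
variable {M N C : Type*} [AddCommGroup M] [Module k M] [AddCommGroup N] [Module k N]
  [AddCommGroup C] [Module k C]
variable {A : HopfStructure k H} (X : HopfBimodule A M) (Y : HopfBimodule A N)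

/-- The underlying module of the tensor product over `H`. -/
abbrev Tensor := BalancedTensor X.ract Y.lact

/-- `m ⊗_H n`. -/
noncomputable abbrev tmk : M →ₗ[k] N →ₗ[k] X.Tensor Y := BalancedTensor.mk X.ract Y.lact

noncomputable def tensorLact : H →ₗ[k] X.Tensor Y →ₗ[k] X.Tensor Y :=
  (BalancedTensor.lift (mkTrilin (fun m n h => X.tmk Y (X.lact h m) n) (by fun_prop) (by fun_prop)
    (by fun_prop)) (fun m h n => by ext g; simp [← mk_ract, X.lact_ract])).flip

noncomputable def tensorRact : X.Tensor Y →ₗ[k] H →ₗ[k] X.Tensor Y :=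
  BalancedTensor.lift (mkTrilin (fun m n h => X.tmk Y m (Y.ract n h)) (by fun_prop) (by fun_prop)
    (by fun_prop)) (fun m h n => by ext g; simp [mk_ract, Y.lact_ract])

noncomputable def tensorRho : X.Tensor Y →ₗ[k] H ⊗[k] X.Tensor Y :=
  BalancedTensor.lift (mkBilin (fun m n => sw (X.ρ m) fun a m => sw (Y.ρ n) fun b n =>
    A.mul a b ⊗ₜ[k] X.tmk Y m n) (by fun_prop) (by fun_prop)) (fun m h n => by
      simp (disch := fun_prop) only [mkBilin_apply, X.sw_ρ_ract, Y.sw_ρ_lact, mk_ract, A.mul_assoc])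

noncomputable def tensorSigma : X.Tensor Y →ₗ[k] X.Tensor Y ⊗[k] H :=
  BalancedTensor.lift (mkBilin (fun m n => sw (X.σ m) fun m a => sw (Y.σ n) fun n b =>
    X.tmk Y m n ⊗ₜ[k] A.mul a b) (by fun_prop) (by fun_prop)) (fun m h n => by
      simp (disch := fun_prop) only [mkBilin_apply, X.sw_σ_ract, Y.sw_σ_lact, mk_ract, A.mul_assoc])

@[simp] theorem tensorLact_mk (h : H) (m : M) (n : N) :
    X.tensorLact Y h (X.tmk Y m n) = X.tmk Y (X.lact h m) n := by
  simp [tensorLact]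

@[simp] theorem tensorRact_mk (h : H) (m : M) (n : N) :
    X.tensorRact Y (X.tmk Y m n) h = X.tmk Y m (Y.ract n h) := by
  simp [tensorRact]

theorem tensorRho_mk (m : M) (n : N) : X.tensorRho Y (X.tmk Y m n) =
    sw (X.ρ m) fun a m => sw (Y.ρ n) fun b n => A.mul a b ⊗ₜ[k] X.tmk Y m n := by
  simp [tensorRho]

theorem tensorSigma_mk (m : M) (n : N) : X.tensorSigma Y (X.tmk Y m n) =
    sw (X.σ m) fun m a => sw (Y.σ n) fun n b => X.tmk Y m n ⊗ₜ[k] A.mul a b := by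
  simp [tensorSigma]

/-- The tensor product over `H` of bicovariant bimodules. -/
noncomputable def tensor : HopfBimodule A (X.Tensor Y) where
  lact := X.tensorLact Y
  ract := X.tensorRact Y
  ρ := X.tensorRho Y
  σ := X.tensorSigma Y
  mul_lact g h := BalancedTensor.ext_lin (by fun_prop) (by fun_prop) fun m n => by
    simp [X.mul_lact]
  one_lact := BalancedTensor.ext_lin (by fun_prop) (by fun_prop) fun m n => by
    simp [X.one_lact]
  ract_mul m g h := by
    revert m
    exact BalancedTensor.ext_lin (by fun_prop) (by fun_prop) fun m n => by simp [Y.ract_mul]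
  ract_one := BalancedTensor.ext_lin (by fun_prop) (by fun_prop) fun m n => by
    simp [Y.ract_one]
  lact_ract g m h := by
    revert m
    exact BalancedTensor.ext_lin (by fun_prop) (by fun_prop) fun m n => by simp
  ρ_coassoc := BalancedTensor.ext_lin (by fun_prop) (by fun_prop) fun m n => by
    simp (disch := fun_prop) only [tensorRho_mk, sw_sw, sw_tmul, A.sw_comul_mul, tmul_sw]
    simp only [sw_comm (Y.ρ n) (A.comul _), sw_comm (Y.ρ n) (X.ρ _)]
    simp (disch := fun_prop) only [X.sw_ρ_coassoc, Y.sw_ρ_coassoc]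
  ρ_counit := BalancedTensor.ext_lin (by fun_prop) (by fun_prop) fun m n => by
    simp (disch := fun_prop) only [tensorRho_mk, sw_sw, sw_tmul, A.counit_mul, mul_smul]
    simp (disch := fun_prop) only [← smul_sw, Y.sw_ρ_counit, X.sw_ρ_counit]
  σ_coassoc := BalancedTensor.ext_lin (by fun_prop) (by fun_prop) fun m n => by
    simp (disch := fun_prop) only [tensorSigma_mk, sw_sw, sw_tmul, A.sw_comul_mul, sw_tmul_right]
    simp only [sw_comm (Y.σ n) (A.comul _), sw_comm (Y.σ n) (X.σ _)]
    simp (disch := fun_prop) only [X.sw_σ_coassoc, Y.sw_σ_coassoc]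
  σ_counit := BalancedTensor.ext_lin (by fun_prop) (by fun_prop) fun m n => by
    simp (disch := fun_prop) only [tensorSigma_mk, sw_sw, sw_tmul, A.counit_mul, mul_smul]
    simp (disch := fun_prop) only [← smul_sw, Y.sw_σ_counit, X.sw_σ_counit]
  ρ_lact h := BalancedTensor.ext_lin (by fun_prop) (by fun_prop) fun m n => by
    simp (disch := fun_prop) only [tensorRho_mk, sw_sw, sw_tmul, tensorLact_mk, X.sw_ρ_lact, A.mul_assoc]
  ρ_ract m h := by
    revert m
    exact BalancedTensor.ext_lin (by fun_prop) (by fun_prop) fun m n => by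
      simp (disch := fun_prop) only [tensorRho_mk, sw_sw, sw_tmul, tensorRact_mk, Y.sw_ρ_ract, A.mul_assoc]
  σ_lact h := BalancedTensor.ext_lin (by fun_prop) (by fun_prop) fun m n => by
    simp (disch := fun_prop) only [tensorSigma_mk, sw_sw, sw_tmul, tensorLact_mk, X.sw_σ_lact, A.mul_assoc]
  σ_ract m h := by
    revert m
    exact BalancedTensor.ext_lin (by fun_prop) (by fun_prop) fun m n => by
      simp (disch := fun_prop) only [tensorSigma_mk, sw_sw, sw_tmul, tensorRact_mk, Y.sw_σ_ract, A.mul_assoc]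
  ρ_σ := BalancedTensor.ext_lin (by fun_prop) (by fun_prop) fun m n => by
    simp (disch := fun_prop) only [tensorRho_mk, tensorSigma_mk, sw_sw, sw_tmul, tmul_sw]
    simp only [sw_comm (Y.ρ n) (X.σ _), sw_comm (Y.σ n) (X.ρ _)]
    simp (disch := fun_prop) only [X.sw_ρ_σ, Y.sw_ρ_σ]

end HopfBimodule

/-! ### The prebraiding of ordinary bicovariant bimodules and its inverse -/

namespace HopfBimodule

open BalancedTensor (mk_ract)

variable {k H : Type*} [CommRing k] [AddCommGroup H] [Module k H]
variable {M N M' N' C : Type*} [AddCommGroup M] [Module k M] [AddCommGroup N] [Module k N]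
  [AddCommGroup M'] [Module k M'] [AddCommGroup N'] [Module k N'] [AddCommGroup C] [Module k C]
variable {A : HopfStructure k H} (X : HopfBimodule A M) (Y : HopfBimodule A N)

/-- Write `m = m₍₋₁₎P_L(m₍₀₎)` and `n = P_R(n_[0])n_[1]`; the outer factors come out as left and
right actions on `M ⊗_H N`. The target needs no module axioms, only operations `Φ`, `Ψ` common to
both maps, so diagonal actions on `H ⊗ (N ⊗_H M)` can be used directly. -/
theorem eq_of_eq_on_coinvariants {f g : X.Tensor Y →ₗ[k] C} (Φ : H → C → C) (Ψ : C → H → C)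
    (hf : ∀ h x, f (X.tensorLact Y h x) = Φ h (f x)) (hg : ∀ h x, g (X.tensorLact Y h x) = Φ h (g x))
    (hf' : ∀ h x, f (X.tensorRact Y x h) = Ψ (f x) h)
    (hg' : ∀ h x, g (X.tensorRact Y x h) = Ψ (g x) h)
    (h : ∀ m n, X.ρ m = A.one ⊗ₜ[k] m → Y.σ n = n ⊗ₜ[k] A.one →
      f (X.tmk Y m n) = g (X.tmk Y m n)) : f = g := by
  refine BalancedTensor.hom_ext fun m n => ?_
  change f (X.tmk Y m n) = g (X.tmk Y m n)
  rw [← X.sw_lact_projL m, ← Y.sw_ract_projR n]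
  simp only [map_sw, sw_apply, ← tensorLact_mk, ← tensorRact_mk, hf, hg, hf', hg',
    h _ _ (X.ρ_projL _) (Y.σ_projR _)]

/-- `m ⊗_H n ↦ m₍₋₁₎P_R(n_[0]) ⊗_H P_L(m₍₀₎)n_[1]`. -/
noncomputable def braid : X.Tensor Y →ₗ[k] Y.Tensor X :=
  BalancedTensor.lift (mkBilin (fun m n => sw (X.ρ m) fun a m => sw (Y.σ n) fun n b =>
    Y.tmk X (Y.lact a (Y.projR n)) (X.ract (X.projL m) b)) (by fun_prop) (by fun_prop))
    (fun m h n => by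
      simp (disch := fun_prop) only [mkBilin_apply, X.sw_ρ_ract, Y.sw_σ_lact, X.projL_ract,
        Y.projR_lact, map_sw, sw_apply]
      -- Both sides amount to `m₍₋₁₎h₁P_R(n_[0])S(h₂) ⊗ P_L(m₍₀₎)h₃n_[1]`: the factor `S(h₂)` comes
      -- from `P_L(mh)` on one side and from `P_R(hn)` on the other, and it moves across the
      -- balanced tensor.
      refine congrArg (sw (X.ρ m)) (funext₂ fun a m => ?_)
      simp only [← Y.mul_lact, ← X.ract_mul, sw_comm (Y.σ n) (A.comul _)]
      simp (disch := fun_prop) only [A.sw_coassoc, ← Y.lact_ract, mk_ract, X.lact_ract])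

theorem braid_mk (m : M) (n : N) : X.braid Y (X.tmk Y m n) = sw (X.ρ m) fun a m => 
    sw (Y.σ n) fun n b => Y.tmk X (Y.lact a (Y.projR n)) (X.ract (X.projL m) b) := by
  simp [braid]

theorem braid_lact (h : H) : ∀ x, X.braid Y (X.tensorLact Y h x) = Y.tensorLact X h (X.braid Y x) :=
  BalancedTensor.ext_lin (by fun_prop) (by fun_prop) fun m n => by
    simp (disch := fun_prop) only [tensorLact_mk, braid_mk, X.sw_ρ_lact, map_sw, X.projL_lact,
      map_smul, LinearMap.smul_apply, ← smul_sw]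
    rw [A.sw_comul_counit h (fun a => sw (X.ρ m) fun c m => sw (Y.σ n) fun n b =>
      Y.tmk X (Y.lact (A.mul a c) (Y.projR n)) (X.ract (X.projL m) b)) (by fun_prop)]
    simp only [Y.mul_lact]

theorem braid_ract (h : H) : ∀ x, X.braid Y (X.tensorRact Y x h) = Y.tensorRact X (X.braid Y x) h :=
  BalancedTensor.ext_lin (by fun_prop) (by fun_prop) fun m n => by
    simp (disch := fun_prop) only [tensorRact_mk, braid_mk, Y.sw_σ_ract, map_sw, Y.projR_ract,
      map_smul, LinearMap.smul_apply, sw_apply]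
    refine congrArg (sw (X.ρ m)) (funext₂ fun a m => ?_)
    refine congrArg (sw (Y.σ n)) (funext₂ fun n b => ?_)
    rw [A.sw_counit_comul h (fun c =>
      Y.tmk X (Y.lact a (Y.projR n)) (X.ract (X.projL m) (A.mul b c))) (by fun_prop)]
    simp only [X.ract_mul]

/-- With bilinearity over `H` this determines the braiding; later identities are checked on this
formula. -/
theorem braid_mk_of_coinvariant {m : M} {n : N} (hm : X.ρ m = A.one ⊗ₜ[k] m)
    (hn : Y.σ n = n ⊗ₜ[k] A.one) : X.braid Y (X.tmk Y m n) = Y.tmk X n m := by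
  rw [braid_mk, hm, hn]
  simp (disch := fun_prop) only [sw_tmul, X.projL_of_coinvariant hm, Y.projR_of_coinvariant hn,
    Y.one_lact, X.ract_one]

/-- Both sides intertwine the actions of `H` with the diagonal actions on `H ⊗ (N ⊗_H M)`, so they
need only be compared on coinvariant generators. -/
theorem tensorRho_braid (x : X.Tensor Y) : Y.tensorRho X (X.braid Y x) =
    sw (X.tensorRho Y x) fun a y => a ⊗ₜ[k] X.braid Y y := by
  have hl : Lin k fun x => sw (X.tensorRho Y x) fun a y => a ⊗ₜ[k] X.braid Y y := by fun_prop
  have : Y.tensorRho X ∘ₗ X.braid Y = hl.toLinearMap := by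
    refine X.eq_of_eq_on_coinvariants Y
      (fun h z => sw (A.comul h) fun a b => sw z fun c y => A.mul a c ⊗ₜ[k] Y.tensorLact X b y)
      (fun z h => sw z fun c y => sw (A.comul h) fun a b => A.mul c a ⊗ₜ[k] Y.tensorRact X y b)
      ?_ ?_ ?_ ?_ ?_
    · intro h x
      simp only [LinearMap.comp_apply, braid_lact]
      exact (Y.tensor X).ρ_lact h _
    · intro h x
      have := (X.tensor Y).sw_ρ_lact h x (fun a y => a ⊗ₜ[k] X.braid Y y) (by fun_prop) (by fun_prop)
      simp only [tensor] at this
      simp (disch := fun_prop) only [Lin.toLinearMap_apply, this, sw_sw, sw_tmul, braid_lact]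
    · intro h x
      simp only [LinearMap.comp_apply, braid_ract]
      exact (Y.tensor X).ρ_ract _ h
    · intro h x
      have := (X.tensor Y).sw_ρ_ract x h (fun a y => a ⊗ₜ[k] X.braid Y y) (by fun_prop) (by fun_prop)
      simp only [tensor] at this
      simp (disch := fun_prop) only [Lin.toLinearMap_apply, this, sw_sw, sw_tmul, braid_ract]
    · intro m n hm hn
      -- The components of `ρ(n)` in `N` may be taken right coinvariant, so the braiding is still a
      -- flip after the coaction has been applied.
      have h1 := Y.ρ_projR n
      rw [Y.projR_of_coinvariant hn] at h1
      simp only [LinearMap.comp_apply, Lin.toLinearMap_apply, X.braid_mk_of_coinvariant Y hm hn,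
        tensorRho_mk]
      rw [h1, hm]
      simp (disch := fun_prop) only [sw_sw, sw_tmul, A.one_mul, A.mul_one,
        X.braid_mk_of_coinvariant Y hm (Y.σ_projR _)]
  exact LinearMap.congr_fun this x

theorem tensorSigma_braid (x : X.Tensor Y) : Y.tensorSigma X (X.braid Y x) =
    sw (X.tensorSigma Y x) fun y a => X.braid Y y ⊗ₜ[k] a := by
  have hl : Lin k fun x => sw (X.tensorSigma Y x) fun y a => X.braid Y y ⊗ₜ[k] a := by fun_prop
  have : Y.tensorSigma X ∘ₗ X.braid Y = hl.toLinearMap := by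
    refine X.eq_of_eq_on_coinvariants Y
      (fun h z => sw (A.comul h) fun a b => sw z fun y c => Y.tensorLact X a y ⊗ₜ[k] A.mul b c)
      (fun z h => sw z fun y c => sw (A.comul h) fun a b => Y.tensorRact X y a ⊗ₜ[k] A.mul c b)
      ?_ ?_ ?_ ?_ ?_
    · intro h x
      simp only [LinearMap.comp_apply, braid_lact]
      exact (Y.tensor X).σ_lact h _
    · intro h x
      have := (X.tensor Y).sw_σ_lact h x (fun y a => X.braid Y y ⊗ₜ[k] a) (by fun_prop) (by fun_prop)
      simp only [tensor] at this
      simp (disch := fun_prop) only [Lin.toLinearMap_apply, this, sw_sw, sw_tmul, braid_lact]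
    · intro h x
      simp only [LinearMap.comp_apply, braid_ract]
      exact (Y.tensor X).σ_ract _ h
    · intro h x
      have := (X.tensor Y).sw_σ_ract x h (fun y a => X.braid Y y ⊗ₜ[k] a) (by fun_prop) (by fun_prop)
      simp only [tensor] at this
      simp (disch := fun_prop) only [Lin.toLinearMap_apply, this, sw_sw, sw_tmul, braid_ract]
    · intro m n hm hn
      have h1 := X.σ_projL m
      rw [X.projL_of_coinvariant hm] at h1
      simp only [LinearMap.comp_apply, Lin.toLinearMap_apply, X.braid_mk_of_coinvariant Y hm hn,
        tensorSigma_mk]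
      rw [h1, hn]
      simp (disch := fun_prop) only [sw_sw, sw_tmul, A.one_mul, A.mul_one,
        X.braid_mk_of_coinvariant Y (X.ρ_projL _) hn]
  exact LinearMap.congr_fun this x

section Inverse

variable (T : H →ₗ[k] H) (hT : ∀ h, A.antipode (T h) = h) (hT' : ∀ h, T (A.antipode h) = h)

/-- The braiding of the co-opposite structures, which is inverse to `braid`. -/
noncomputable def braidInv : Y.Tensor X →ₗ[k] X.Tensor Y :=
  (Y.cop T hT hT').braid (X.cop T hT hT')

theorem braidInv_lact (h : H) (x : Y.Tensor X) : X.braidInv Y T hT hT' (Y.tensorLact X h x) =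
    X.tensorLact Y h (X.braidInv Y T hT hT' x) :=
  braid_lact (Y.cop T hT hT') (X.cop T hT hT') h x

theorem braidInv_ract (h : H) (x : Y.Tensor X) : X.braidInv Y T hT hT' (Y.tensorRact X x h) =
    X.tensorRact Y (X.braidInv Y T hT hT' x) h :=
  braid_ract (Y.cop T hT hT') (X.cop T hT hT') h x

/-- Exchanging the coactions makes `n` left coinvariant and `m` right coinvariant, so the
co-opposite braiding flips them back. -/
theorem braidInv_mk_of_coinvariant {m : M} {n : N} (hm : X.ρ m = A.one ⊗ₜ[k] m)
    (hn : Y.σ n = n ⊗ₜ[k] A.one) : X.braidInv Y T hT hT' (Y.tmk X n m) = X.tmk Y m n :=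
  braid_mk_of_coinvariant (Y.cop T hT hT') (X.cop T hT hT')
    (by simp [cop, hn, HopfStructure.cop]) (by simp [cop, hm, HopfStructure.cop])

theorem braidInv_braid (x : X.Tensor Y) : X.braidInv Y T hT hT' (X.braid Y x) = x := by
  have : X.braidInv Y T hT hT' ∘ₗ X.braid Y = LinearMap.id := by
    refine X.eq_of_eq_on_coinvariants Y (fun h => X.tensorLact Y h) (fun x h => X.tensorRact Y x h)
      ?_ (fun _ _ => rfl) ?_ (fun _ _ => rfl) ?_
    · intro h x
      rw [LinearMap.comp_apply, braid_lact, braidInv_lact, LinearMap.comp_apply]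
    · intro h x
      rw [LinearMap.comp_apply, braid_ract, braidInv_ract, LinearMap.comp_apply]
    · intro m n hm hn
      rw [LinearMap.comp_apply, X.braid_mk_of_coinvariant Y hm hn,
        X.braidInv_mk_of_coinvariant Y T hT hT' hm hn, LinearMap.id_apply]
  exact LinearMap.congr_fun this x

theorem braid_braidInv (x : Y.Tensor X) : X.braid Y (X.braidInv Y T hT hT' x) = x := by
  have : X.braid Y ∘ₗ X.braidInv Y T hT hT' = LinearMap.id := by
    -- On `N ⊗_H M` the generators needed are a right coinvariant `n` and a left coinvariant `m`,
    -- which is what the co-opposite structures supply. The actions are unchanged, so the underlying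
    -- tensor product is the same.
    refine eq_of_eq_on_coinvariants (Y.cop T hT hT') (X.cop T hT hT')
      (fun h => Y.tensorLact X h) (fun x h => Y.tensorRact X x h)
      (fun h (x : Y.Tensor X) => ?_) (fun _ _ => rfl) (fun h (x : Y.Tensor X) => ?_)
      (fun _ _ => rfl) ?_
    · change X.braid Y (X.braidInv Y T hT hT' (Y.tensorLact X h x)) = _
      rw [braidInv_lact, braid_lact]
      rfl
    · change X.braid Y (X.braidInv Y T hT hT' (Y.tensorRact X x h)) = _
      rw [braidInv_ract, braid_ract]
      rfl
    · intro n m hn hm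
      replace hn : Y.σ n = n ⊗ₜ[k] A.one := by
        simpa [cop, HopfStructure.cop] using congrArg (TensorProduct.comm k _ _) hn
      replace hm : X.ρ m = A.one ⊗ₜ[k] m := by
        simpa [cop, HopfStructure.cop] using congrArg (TensorProduct.comm k _ _) hm
      change X.braid Y (X.braidInv Y T hT hT' (Y.tmk X n m)) = Y.tmk X n m
      rw [X.braidInv_mk_of_coinvariant Y T hT hT' hm hn, X.braid_mk_of_coinvariant Y hm hn]
  exact LinearMap.congr_fun this x

end Inverse

theorem braid_bijective (hS : Function.Bijective A.antipode) : Function.Bijective (X.braid Y) := by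
  let e := LinearEquiv.ofBijective A.antipode hS
  exact Function.bijective_iff_has_inverse.mpr ⟨X.braidInv Y e.symm e.apply_symm_apply e.symm_apply_apply,
    X.braidInv_braid Y _ _ _, X.braid_braidInv Y _ _ _⟩

end HopfBimodule

/-! ### Homomorphisms along an endomorphism of `H` -/

section Homs

variable {k H : Type*} [CommRing k] [AddCommGroup H] [Module k H]
variable {M N M' N' : Type*} [AddCommGroup M] [Module k M] [AddCommGroup N] [Module k N]
  [AddCommGroup M'] [Module k M'] [AddCommGroup N'] [Module k N']
variable {A : HopfStructure k H}

/-- `φ` respects products and antipodes. -/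
structure HopfStructure.IsEndo (A : HopfStructure k H) (φ : H →ₗ[k] H) : Prop where
  map_mul : ∀ a b, φ (A.mul a b) = A.mul (φ a) (φ b)
  map_antipode : ∀ a, φ (A.antipode a) = A.antipode (φ a)

theorem HopfStructure.IsEndo.id : A.IsEndo LinearMap.id := ⟨fun _ _ => rfl, fun _ => rfl⟩

namespace HopfBimodule

open BalancedTensor (mk_ract)

/-- `f` is a homomorphism of bicovariant bimodules along `φ`. -/
structure IsHom (φ : H →ₗ[k] H) (X : HopfBimodule A M) (X' : HopfBimodule A M') (f : M →ₗ[k] M') :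
    Prop where
  map_lact : ∀ h m, f (X.lact h m) = X'.lact (φ h) (f m)
  map_ract : ∀ m h, f (X.ract m h) = X'.ract (f m) (φ h)
  map_ρ : ∀ m, X'.ρ (f m) = sw (X.ρ m) fun a n => φ a ⊗ₜ[k] f n
  map_σ : ∀ m, X'.σ (f m) = sw (X.σ m) fun n a => f n ⊗ₜ[k] φ a

variable {φ : H →ₗ[k] H} {X : HopfBimodule A M} {X' : HopfBimodule A M'} {Y : HopfBimodule A N}
  {Y' : HopfBimodule A N'} {f : M →ₗ[k] M'} {g : N →ₗ[k] N'}

theorem IsHom.symm {φ : H ≃ₗ[k] H} {f : M ≃ₗ[k] M'} (hf : IsHom φ.toLinearMap X X' f.toLinearMap) :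
    IsHom φ.symm.toLinearMap X' X f.symm.toLinearMap where
  map_lact h m := by
    apply f.injective
    simpa using (hf.map_lact (φ.symm h) (f.symm m)).symm
  map_ract m h := by
    apply f.injective
    simpa using (hf.map_ract (f.symm m) (φ.symm h)).symm
  map_ρ m := by
    have := hf.map_ρ (f.symm m)
    simp only [LinearEquiv.coe_coe, LinearEquiv.apply_symm_apply] at this
    simp (disch := fun_prop) only [this, sw_sw, sw_tmul, LinearEquiv.coe_coe,
      LinearEquiv.symm_apply_apply, sw_tmul_self]
  map_σ m := by
    have := hf.map_σ (f.symm m)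
    simp only [LinearEquiv.coe_coe, LinearEquiv.apply_symm_apply] at this
    simp (disch := fun_prop) only [this, sw_sw, sw_tmul, LinearEquiv.coe_coe,
      LinearEquiv.symm_apply_apply, sw_tmul_self]

theorem IsHom.map_projL (hf : IsHom φ X X' f) (hφ : A.IsEndo φ) (m : M) :
    f (X.projL m) = X'.projL (f m) := by
  simp (disch := fun_prop) only [projL_apply, hf.map_ρ, sw_sw, sw_tmul, map_sw, hf.map_lact,
    hφ.map_antipode]

theorem IsHom.map_projR (hf : IsHom φ X X' f) (hφ : A.IsEndo φ) (m : M) :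
    f (X.projR m) = X'.projR (f m) := by
  simp (disch := fun_prop) only [projR_apply, hf.map_σ, sw_sw, sw_tmul, map_sw, hf.map_ract,
    hφ.map_antipode]

/-- `m ⊗_H n ↦ f(m) ⊗_H g(n)`. -/
noncomputable def tensorMap (hf : IsHom φ X X' f) (hg : IsHom φ Y Y' g) :
    X.Tensor Y →ₗ[k] X'.Tensor Y' :=
  BalancedTensor.lift ((X'.tmk Y').compl₁₂ f g) fun m h n => by
    simp [hf.map_ract, hg.map_lact, mk_ract]

@[simp] theorem tensorMap_mk (hf : IsHom φ X X' f) (hg : IsHom φ Y Y' g) (m : M) (n : N) :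
    tensorMap hf hg (X.tmk Y m n) = X'.tmk Y' (f m) (g n) := by
  simp [tensorMap]

theorem isHom_tensorMap (hφ : A.IsEndo φ) (hf : IsHom φ X X' f) (hg : IsHom φ Y Y' g) :
    IsHom φ (X.tensor Y) (X'.tensor Y') (tensorMap hf hg) where
  map_lact h := BalancedTensor.ext_lin (by fun_prop) (by fun_prop) fun m n => by
    simp [tensor, hf.map_lact]
  map_ract m h := by
    revert m
    exact BalancedTensor.ext_lin (by fun_prop) (by fun_prop) fun m n => by
      simp [tensor, hg.map_ract]
  map_ρ := BalancedTensor.ext_lin (by fun_prop) (by fun_prop) fun m n => by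
    simp (disch := fun_prop) only [tensor, tensorMap_mk, tensorRho_mk, hf.map_ρ, hg.map_ρ, sw_sw,
      sw_tmul, hφ.map_mul]
  map_σ := BalancedTensor.ext_lin (by fun_prop) (by fun_prop) fun m n => by
    simp (disch := fun_prop) only [tensor, tensorMap_mk, tensorSigma_mk, hf.map_σ, hg.map_σ, sw_sw,
      sw_tmul, hφ.map_mul]

/-- Used twice: for `φ = id` it is naturality of the prebraiding, for `φ = α` it says that the
prebraiding commutes with the automorphisms of the Hom-bimodules. -/
theorem braid_tensorMap (hφ : A.IsEndo φ) (hf : IsHom φ X X' f) (hg : IsHom φ Y Y' g) :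
    ∀ x, X'.braid Y' (tensorMap hf hg x) = tensorMap hg hf (X.braid Y x) :=
  BalancedTensor.ext_lin (by fun_prop) (by fun_prop) fun m n => by
    simp (disch := fun_prop) only [tensorMap_mk, braid_mk, hf.map_ρ, hg.map_σ, sw_sw, sw_tmul,
      map_sw, hg.map_lact, hf.map_ract, hf.map_projL hφ, hg.map_projR hφ]

theorem isHom_braid (X : HopfBimodule A M) (Y : HopfBimodule A N) :
    IsHom LinearMap.id (X.tensor Y) (Y.tensor X) (X.braid Y) where
  map_lact := X.braid_lact Y
  map_ract x h := X.braid_ract Y h x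
  map_ρ := X.tensorRho_braid Y
  map_σ := X.tensorSigma_braid Y

/-- The automorphism `f ⊗_H g` for automorphisms along `φ`. -/
noncomputable def tensorEquiv {φ : H ≃ₗ[k] H} {f : M ≃ₗ[k] M'} {g : N ≃ₗ[k] N'}
    (hf : IsHom φ.toLinearMap X X' f.toLinearMap) (hg : IsHom φ.toLinearMap Y Y' g.toLinearMap) :
    X.Tensor Y ≃ₗ[k] X'.Tensor Y' :=
  LinearEquiv.ofLinearMap (tensorMap hf hg) (tensorMap hf.symm hg.symm)
    (BalancedTensor.hom_ext fun m n => by simp) (BalancedTensor.hom_ext fun m n => by simp)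

theorem tensorEquiv_mk {φ : H ≃ₗ[k] H} {f : M ≃ₗ[k] M'} {g : N ≃ₗ[k] N'}
    (hf : IsHom φ.toLinearMap X X' f.toLinearMap) (hg : IsHom φ.toLinearMap Y Y' g.toLinearMap)
    (m : M) (n : N) : tensorEquiv hf hg (X.tmk Y m n) = X'.tmk Y' (f m) (g n) :=
  tensorMap_mk hf hg m n

end HopfBimodule

end Homs

/-! ### Untwisting a monoidal Hom-Hopf algebra -/

namespace MonoidalHomHopfAlgebra

variable {k : Type*} {H : Type*} [CommRing k] [AddCommGroup H] [Module k H]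
variable (𝓗 : MonoidalHomHopfAlgebra k H) {C : Type*} [AddCommGroup C] [Module k C]

theorem sw_comul_α (h : H) (F : H → H → C) (h1 : ∀ b, Lin k fun a => F a b)
    (h2 : ∀ a, Lin k fun b => F a b) :
    sw (𝓗.comul (𝓗.α h)) F = sw (𝓗.comul h) fun a b => F (𝓗.α a) (𝓗.α b) := by
  simp (disch := fun_prop) only [𝓗.comul_α, map_eq_sw, sw_sw, sw_tmul, LinearEquiv.coe_coe]

theorem sw_hom_coassoc (h : H) (F : H → H → H → C) (h1 : ∀ b c, Lin k fun a => F a b c)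
    (h2 : ∀ a c, Lin k fun b => F a b c) (h3 : ∀ a b, Lin k fun c => F a b c) :
    sw (𝓗.comul h) (fun a b => sw (𝓗.comul a) fun c d => F c d (𝓗.α.symm b)) =
      sw (𝓗.comul h) fun a b => sw (𝓗.comul b) fun c d => F (𝓗.α.symm a) c d := by
  have := sw_congr_of_eq (𝓗.hom_coassoc h) (fun a u => sw u fun b c => F a b c)
  simp (disch := fun_prop) only [map_eq_sw, map_sw, sw_sw, sw_tmul, assoc_tmul_eq_sw,
    LinearEquiv.coe_coe] at this
  exact this.symm

theorem comul_mul_eq_sw (g h : H) : 𝓗.comul (𝓗.mul g h) =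
    sw (𝓗.comul g) fun a b => sw (𝓗.comul h) fun c d => 𝓗.mul a c ⊗ₜ[k] 𝓗.mul b d := by
  rw [𝓗.comul_mul, map₂_eq_sw]

theorem α_symm_mul (a b : H) :
    𝓗.α.symm (𝓗.mul a b) = 𝓗.mul (𝓗.α.symm a) (𝓗.α.symm b) := by
  apply 𝓗.α.injective; simp [𝓗.α_mul]

theorem α_symm_one : 𝓗.α.symm 𝓗.one = 𝓗.one := by
  apply 𝓗.α.injective; simp [𝓗.α_one]

theorem counit_α_symm (h : H) : 𝓗.counit (𝓗.α.symm h) = 𝓗.counit h := by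
  rw [← 𝓗.counit_α]; simp

/-- The ordinary Hopf algebra with product `α⁻¹(ab)` and coproduct `Δ(α(h))`. -/
noncomputable def untwist : HopfStructure k H where
  mul := mkBilin (fun a b => 𝓗.α.symm (𝓗.mul a b)) (by fun_prop) (by fun_prop)
  one := 𝓗.one
  comul := 𝓗.comul ∘ₗ 𝓗.α.toLinearMap
  counit := 𝓗.counit
  antipode := 𝓗.antipode
  mul_assoc a b c := by
    -- Two nested untwisted products contribute `α⁻²` to the innermost factors and `α⁻¹` to the
    -- outer one, which is Hom-associativity at `α⁻²(a)`, `α⁻²(b)`, `α⁻²(c)`.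
    have := 𝓗.hom_assoc (𝓗.α.symm (𝓗.α.symm a)) (𝓗.α.symm (𝓗.α.symm b))
      (𝓗.α.symm (𝓗.α.symm c))
    simp only [mkBilin_apply, 𝓗.α_symm_mul]
    simpa using this.symm
  one_mul a := by simp [𝓗.one_mul]
  mul_one a := by simp [𝓗.mul_one]
  coassoc h := by
    simp (disch := fun_prop) only [LinearMap.comp_apply, LinearEquiv.coe_coe, 𝓗.sw_comul_α]
    have := 𝓗.sw_hom_coassoc h (fun a b c =>
      𝓗.α (𝓗.α a) ⊗ₜ[k] (𝓗.α (𝓗.α b) ⊗ₜ[k] 𝓗.α (𝓗.α c))) (by fun_prop) (by fun_prop) (by fun_prop)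
    simp (disch := fun_prop) only [LinearEquiv.apply_symm_apply] at this
    simp (disch := fun_prop) only [this, 𝓗.comul_α, map_eq_sw, tmul_sw, LinearEquiv.coe_coe, sw_sw,
      sw_tmul]
  counit_comul h := by
    have := 𝓗.counit_comul (𝓗.α h)
    simp only [rTensor_eq_sw, map_sw, TensorProduct.lid_tmul, LinearEquiv.symm_apply_apply] at this
    exact this
  comul_counit h := by
    have := 𝓗.comul_counit (𝓗.α h)
    simp only [lTensor_eq_sw, map_sw, TensorProduct.rid_tmul, LinearEquiv.symm_apply_apply] at this
    exact this
  comul_mul g h := by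
    simp (disch := fun_prop) only [LinearMap.comp_apply, LinearEquiv.coe_coe, 𝓗.sw_comul_α,
      mkBilin_apply, LinearEquiv.apply_symm_apply, 𝓗.comul_mul_eq_sw]
    simp only [𝓗.α_symm_mul, LinearEquiv.symm_apply_apply]
  comul_one := by simp [𝓗.α_one, 𝓗.comul_one]
  counit_mul g h := by simp [𝓗.counit_α_symm, 𝓗.counit_mul]
  counit_one := 𝓗.counit_one
  antipode_mul h := by
    have := 𝓗.antipode_mul (𝓗.α h)
    simp only [rTensor_eq_sw, map_sw, TensorProduct.lift.tmul] at this
    simp only [mkBilin_apply, LinearMap.comp_apply, LinearEquiv.coe_coe, ← map_sw, this, map_smul,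
      𝓗.α_symm_one, 𝓗.counit_α]
  mul_antipode h := by
    have := 𝓗.mul_antipode (𝓗.α h)
    simp only [lTensor_eq_sw, map_sw, TensorProduct.lift.tmul] at this
    simp only [mkBilin_apply, LinearMap.comp_apply, LinearEquiv.coe_coe, ← map_sw, this, map_smul,
      𝓗.α_symm_one, 𝓗.counit_α]

theorem mul_eq (a b : H) : 𝓗.mul a b = 𝓗.α (𝓗.untwist.mul a b) := by simp [untwist]

theorem comul_eq (h : H) : 𝓗.comul h = 𝓗.untwist.comul (𝓗.α.symm h) := by simp [untwist]

theorem isEndo_α : 𝓗.untwist.IsEndo 𝓗.α.toLinearMap where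
  map_mul a b := by simp [untwist, 𝓗.α_mul, 𝓗.α_symm_mul]
  map_antipode a := (𝓗.antipode_α a).symm

theorem α_untwist_mul (a b : H) :
    𝓗.α (𝓗.untwist.mul a b) = 𝓗.untwist.mul (𝓗.α a) (𝓗.α b) :=
  𝓗.isEndo_α.map_mul a b

theorem sw_untwist_comul_α (h : H) (F : H → H → C) (h1 : ∀ b, Lin k fun a => F a b)
    (h2 : ∀ a, Lin k fun b => F a b) :
    sw (𝓗.untwist.comul (𝓗.α h)) F = sw (𝓗.untwist.comul h) fun a b => F (𝓗.α a) (𝓗.α b) :=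
  𝓗.sw_comul_α (𝓗.α h) F h1 h2

theorem sw_untwist_comul_α_symm (h : H) (F : H → H → C) (h1 : ∀ b, Lin k fun a => F a b)
    (h2 : ∀ a, Lin k fun b => F a b) : sw (𝓗.untwist.comul (𝓗.α.symm h)) F =
      sw (𝓗.untwist.comul h) fun a b => F (𝓗.α.symm a) (𝓗.α.symm b) := by
  have := 𝓗.sw_untwist_comul_α (𝓗.α.symm h) (fun a b => F (𝓗.α.symm a) (𝓗.α.symm b))
    (by fun_prop) (by fun_prop)
  simpa using this.symm

end MonoidalHomHopfAlgebra

variable {k : Type u} {H : Type v} [CommRing k] [AddCommGroup H] [Module k H]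
  {𝓗 : MonoidalHomHopfAlgebra k H} {M : Type v} [AddCommGroup M] [Module k M]
  {C : Type*} [AddCommGroup C] [Module k C]

/-! ### Untwisting a bicovariant Hom-bimodule -/

namespace BicovariantStructure

variable (s : BicovariantStructure 𝓗 M)

theorem sw_ρ_μ (m : M) (F : H → M → C) (h1 : ∀ b, Lin k fun a => F a b)
    (h2 : ∀ a, Lin k fun b => F a b) :
    sw (s.ρ (s.μ m)) F = sw (s.ρ m) fun a b => F (𝓗.α a) (s.μ b) := by
  simp (disch := fun_prop) only [s.ρ_μ, map_eq_sw, sw_sw, sw_tmul, LinearEquiv.coe_coe]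

theorem sw_σ_μ (m : M) (F : M → H → C) (h1 : ∀ b, Lin k fun a => F a b)
    (h2 : ∀ a, Lin k fun b => F a b) :
    sw (s.σ (s.μ m)) F = sw (s.σ m) fun a b => F (s.μ a) (𝓗.α b) := by
  simp (disch := fun_prop) only [s.σ_μ, map_eq_sw, sw_sw, sw_tmul, LinearEquiv.coe_coe]

theorem sw_ρ_hom_coassoc (m : M) (F : H → H → M → C) (h1 : ∀ b c, Lin k fun a => F a b c)
    (h2 : ∀ a c, Lin k fun b => F a b c) (h3 : ∀ a b, Lin k fun c => F a b c) :
    sw (s.ρ m) (fun a n => sw (𝓗.comul a) fun c d => F c d (s.μ.symm n)) =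
      sw (s.ρ m) fun a n => sw (s.ρ n) fun c d => F (𝓗.α.symm a) c d := by
  have := sw_congr_of_eq (s.ρ_coassoc m) (fun a u => sw u fun b c => F a b c)
  simp (disch := fun_prop) only [map_eq_sw, map_sw, sw_sw, sw_tmul, assoc_tmul_eq_sw,
    LinearEquiv.coe_coe] at this
  exact this.symm

theorem sw_σ_hom_coassoc (m : M) (F : M → H → H → C) (h1 : ∀ b c, Lin k fun a => F a b c)
    (h2 : ∀ a c, Lin k fun b => F a b c) (h3 : ∀ a b, Lin k fun c => F a b c) :
    sw (s.σ m) (fun n a => sw (s.σ n) fun c d => F c d (𝓗.α.symm a)) =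
      sw (s.σ m) fun n a => sw (𝓗.comul a) fun c d => F (s.μ.symm n) c d := by
  have := sw_congr_of_eq (s.σ_coassoc m) (fun a u => sw u fun b c => F a b c)
  simp (disch := fun_prop) only [map_eq_sw, map_sw, sw_sw, sw_tmul, assoc_tmul_eq_sw,
    LinearEquiv.coe_coe] at this
  exact this.symm

theorem sw_hom_comm (m : M) (F : H → M → H → C) (h1 : ∀ b c, Lin k fun a => F a b c)
    (h2 : ∀ a c, Lin k fun b => F a b c) (h3 : ∀ a b, Lin k fun c => F a b c) :
    sw (s.ρ m) (fun a n => sw (s.σ n) fun p b => F a p b) =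
      sw (s.σ m) fun n b => sw (s.ρ n) fun a p => F (𝓗.α a) p (𝓗.α.symm b) := by
  have := sw_congr_of_eq (s.hom_comm m) (fun a u => sw u fun b c => F a b c)
  simpa (disch := fun_prop) only [lTensor_eq_sw, rTensor_eq_sw, map_eq_sw, map_sw, sw_sw, sw_tmul,
    assoc_tmul_eq_sw, LinearEquiv.coe_coe, LinearMap.id_apply] using this

theorem μ_symm_lact (h : H) (m : M) :
    s.μ.symm (s.lact h m) = s.lact (𝓗.α.symm h) (s.μ.symm m) := by
  apply s.μ.injective; simp [s.μ_lact]

theorem μ_symm_ract (m : M) (h : H) :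
    s.μ.symm (s.ract m h) = s.ract (s.μ.symm m) (𝓗.α.symm h) := by
  apply s.μ.injective; simp [s.μ_ract]

/-- The covariance axiom involves both actions at once. Setting `g = 1` leaves the left action up to
one application of the automorphisms, which is undone by `α⁻¹ ⊗ μ⁻¹`; `h = 1` isolates the right
action in the same way. -/
theorem ρ_lact (h : H) (m : M) : s.ρ (s.lact h m) =
    sw (𝓗.comul h) fun a b => sw (s.ρ m) fun c n => 𝓗.mul a c ⊗ₜ[k] s.lact b n := by
  have := s.ρ_covariant h m 𝓗.one
  rw [𝓗.α_one, s.ract_one, 𝓗.comul_one] at this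
  have h2 := congrArg (TensorProduct.map 𝓗.α.symm.toLinearMap s.μ.symm.toLinearMap) this
  rw [s.ρ_μ] at h2
  simp (disch := fun_prop) only [map_eq_sw, map₂_eq_sw, sw_tmul, LinearEquiv.coe_coe,
    LinearEquiv.symm_apply_apply, sw_tmul_self, 𝓗.sw_comul_α, 𝓗.mul_one, s.ract_one, map_sw,
    TensorProduct.map_tmul, 𝓗.α_symm_mul, s.μ_symm_lact] at h2
  rw [sw_comm]
  exact h2

theorem ρ_ract (m : M) (h : H) : s.ρ (s.ract m h) =
    sw (s.ρ m) fun c n => sw (𝓗.comul h) fun a b => 𝓗.mul c a ⊗ₜ[k] s.ract n b := by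
  have := s.ρ_covariant 𝓗.one m h
  rw [𝓗.α_one, s.one_lact, 𝓗.comul_one, ← s.μ_ract] at this
  have h2 := congrArg (TensorProduct.map 𝓗.α.symm.toLinearMap s.μ.symm.toLinearMap) this
  rw [s.ρ_μ] at h2
  simp (disch := fun_prop) only [map_eq_sw, map₂_eq_sw, sw_tmul, LinearEquiv.coe_coe,
    LinearEquiv.symm_apply_apply, sw_tmul_self, 𝓗.one_mul, s.one_lact, map_sw,
    TensorProduct.map_tmul] at h2
  exact h2

theorem σ_lact (h : H) (m : M) : s.σ (s.lact h m) =
    sw (𝓗.comul h) fun a b => sw (s.σ m) fun n c => s.lact a n ⊗ₜ[k] 𝓗.mul b c := by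
  have := s.σ_covariant h m 𝓗.one
  rw [𝓗.α_one, s.ract_one, 𝓗.comul_one] at this
  have h2 := congrArg (TensorProduct.map s.μ.symm.toLinearMap 𝓗.α.symm.toLinearMap) this
  rw [s.σ_μ] at h2
  simp (disch := fun_prop) only [map_eq_sw, map₂_eq_sw, sw_tmul, LinearEquiv.coe_coe,
    LinearEquiv.symm_apply_apply, sw_tmul_self, 𝓗.sw_comul_α, 𝓗.mul_one, s.ract_one, map_sw,
    TensorProduct.map_tmul, 𝓗.α_symm_mul, s.μ_symm_lact] at h2
  rw [sw_comm]
  exact h2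

theorem σ_ract (m : M) (h : H) : s.σ (s.ract m h) =
    sw (s.σ m) fun n c => sw (𝓗.comul h) fun a b => s.ract n a ⊗ₜ[k] 𝓗.mul c b := by
  have := s.σ_covariant 𝓗.one m h
  rw [𝓗.α_one, s.one_lact, 𝓗.comul_one, ← s.μ_ract] at this
  have h2 := congrArg (TensorProduct.map s.μ.symm.toLinearMap 𝓗.α.symm.toLinearMap) this
  rw [s.σ_μ] at h2
  simp (disch := fun_prop) only [map_eq_sw, map₂_eq_sw, sw_tmul, LinearEquiv.coe_coe,
    LinearEquiv.symm_apply_apply, sw_tmul_self, 𝓗.one_mul, s.one_lact, map_sw,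
    TensorProduct.map_tmul] at h2
  exact h2

/-- The ordinary bicovariant bimodule with actions `μ⁻¹(hm)`, `μ⁻¹(mh)` and coactions `ρ(μ(m))`,
`σ(μ(m))`. -/
noncomputable def untwist : HopfBimodule 𝓗.untwist M where
  lact := mkBilin (fun h m => s.μ.symm (s.lact h m)) (by fun_prop) (by fun_prop)
  ract := mkBilin (fun m h => s.μ.symm (s.ract m h)) (by fun_prop) (by fun_prop)
  ρ := s.ρ ∘ₗ s.μ.toLinearMap
  σ := s.σ ∘ₗ s.μ.toLinearMap
  mul_lact g h m := by
    have := s.lact_lact (𝓗.α.symm (𝓗.α.symm g)) (𝓗.α.symm (𝓗.α.symm h))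
      (s.μ.symm (s.μ.symm m))
    simp only [MonoidalHomHopfAlgebra.untwist, mkBilin_apply, 𝓗.α_symm_mul, s.μ_symm_lact]
    simpa using this.symm
  one_lact m := by simp [MonoidalHomHopfAlgebra.untwist, s.one_lact]
  ract_mul m g h := by
    have := s.ract_ract (s.μ.symm (s.μ.symm m)) (𝓗.α.symm (𝓗.α.symm g))
      (𝓗.α.symm (𝓗.α.symm h))
    simp only [MonoidalHomHopfAlgebra.untwist, mkBilin_apply, 𝓗.α_symm_mul, s.μ_symm_ract]
    simpa using this.symm
  ract_one m := by simp [MonoidalHomHopfAlgebra.untwist, s.ract_one]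
  lact_ract g m h := by
    have := s.lact_ract (𝓗.α.symm (𝓗.α.symm g)) (s.μ.symm (s.μ.symm m))
      (𝓗.α.symm (𝓗.α.symm h))
    simp only [mkBilin_apply, s.μ_symm_ract, s.μ_symm_lact]
    simpa using this
  ρ_coassoc m := by
    simp (disch := fun_prop) only [LinearMap.comp_apply, LinearEquiv.coe_coe, 𝓗.sw_comul_α,
      MonoidalHomHopfAlgebra.untwist, s.sw_ρ_μ]
    have := s.sw_ρ_hom_coassoc m (fun a b c =>
      𝓗.α (𝓗.α a) ⊗ₜ[k] (𝓗.α (𝓗.α b) ⊗ₜ[k] s.μ (s.μ c))) (by fun_prop) (by fun_prop) (by fun_prop)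
    simp (disch := fun_prop) only [LinearEquiv.apply_symm_apply] at this
    simp (disch := fun_prop) only [this, s.ρ_μ, map_eq_sw, tmul_sw, LinearEquiv.coe_coe, sw_sw,
      sw_tmul]
  ρ_counit m := by
    have := s.ρ_counit (s.μ m)
    simp only [rTensor_eq_sw, map_sw, TensorProduct.lid_tmul, LinearEquiv.symm_apply_apply] at this
    exact this
  σ_coassoc m := by
    simp (disch := fun_prop) only [LinearMap.comp_apply, LinearEquiv.coe_coe, 𝓗.sw_comul_α,
      MonoidalHomHopfAlgebra.untwist, s.sw_σ_μ]
    have := s.sw_σ_hom_coassoc m (fun a b c =>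
      (s.μ (s.μ a) ⊗ₜ[k] 𝓗.α (𝓗.α b)) ⊗ₜ[k] 𝓗.α (𝓗.α c)) (by fun_prop) (by fun_prop) (by fun_prop)
    simp (disch := fun_prop) only [LinearEquiv.apply_symm_apply] at this
    simp (disch := fun_prop) only [← this, s.σ_μ, map_eq_sw, sw_tmul_right, LinearEquiv.coe_coe,
      sw_sw, sw_tmul]
  σ_counit m := by
    have := s.σ_counit (s.μ m)
    simp only [lTensor_eq_sw, map_sw, TensorProduct.rid_tmul, LinearEquiv.symm_apply_apply] at this
    exact this
  ρ_lact h m := by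
    simp (disch := fun_prop) only [LinearMap.comp_apply, LinearEquiv.coe_coe, 𝓗.sw_comul_α,
      MonoidalHomHopfAlgebra.untwist, s.sw_ρ_μ, mkBilin_apply, LinearEquiv.apply_symm_apply,
      s.ρ_lact]
    simp only [𝓗.α_symm_mul, s.μ_symm_lact, LinearEquiv.symm_apply_apply]
  ρ_ract m h := by
    simp (disch := fun_prop) only [LinearMap.comp_apply, LinearEquiv.coe_coe, 𝓗.sw_comul_α,
      MonoidalHomHopfAlgebra.untwist, s.sw_ρ_μ, mkBilin_apply, LinearEquiv.apply_symm_apply,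
      s.ρ_ract]
    simp only [𝓗.α_symm_mul, s.μ_symm_ract, LinearEquiv.symm_apply_apply]
  σ_lact h m := by
    simp (disch := fun_prop) only [LinearMap.comp_apply, LinearEquiv.coe_coe, 𝓗.sw_comul_α,
      MonoidalHomHopfAlgebra.untwist, s.sw_σ_μ, mkBilin_apply, LinearEquiv.apply_symm_apply,
      s.σ_lact]
    simp only [𝓗.α_symm_mul, s.μ_symm_lact, LinearEquiv.symm_apply_apply]
  σ_ract m h := by
    simp (disch := fun_prop) only [LinearMap.comp_apply, LinearEquiv.coe_coe, 𝓗.sw_comul_α,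
      MonoidalHomHopfAlgebra.untwist, s.sw_σ_μ, mkBilin_apply, LinearEquiv.apply_symm_apply,
      s.σ_ract]
    simp only [𝓗.α_symm_mul, s.μ_symm_ract, LinearEquiv.symm_apply_apply]
  ρ_σ m := by
    simp (disch := fun_prop) only [LinearMap.comp_apply, LinearEquiv.coe_coe, s.sw_ρ_μ,
      s.σ_μ, map_eq_sw, tmul_sw, sw_sw, sw_tmul]
    rw [s.sw_hom_comm m (fun a p b => 𝓗.α a ⊗ₜ[k] (s.μ (s.μ p) ⊗ₜ[k] 𝓗.α (𝓗.α b))) (by fun_prop)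
      (by fun_prop) (by fun_prop)]
    simp only [LinearEquiv.apply_symm_apply]

/-- This is all that remains of the Hom-structure after untwisting, and it is the hypothesis needed
for twisting back. -/
theorem isHom_μ : HopfBimodule.IsHom 𝓗.α.toLinearMap s.untwist s.untwist s.μ.toLinearMap where
  map_lact h m := by simp [untwist, s.μ_lact, s.μ_symm_lact]
  map_ract m h := by simp [untwist, s.μ_ract, s.μ_symm_ract]
  map_ρ m := by
    simp only [untwist, LinearMap.comp_apply, LinearEquiv.coe_coe, s.ρ_μ (s.μ m), map_eq_sw]
  map_σ m := by
    simp only [untwist, LinearMap.comp_apply, LinearEquiv.coe_coe, s.σ_μ (s.μ m), map_eq_sw]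

theorem lact_eq (h : H) (m : M) : s.lact h m = s.μ (s.untwist.lact h m) := by simp [untwist]

theorem ract_eq (m : M) (h : H) : s.ract m h = s.μ (s.untwist.ract m h) := by simp [untwist]

theorem ρ_eq (m : M) : s.ρ m = s.untwist.ρ (s.μ.symm m) := by simp [untwist]

theorem σ_eq (m : M) : s.σ m = s.untwist.σ (s.μ.symm m) := by simp [untwist]

end BicovariantStructure

attribute [ext] HopfBimodule

variable {k : Type u} {H : Type v} [CommRing k] [AddCommGroup H] [Module k H]
  {𝓗 : MonoidalHomHopfAlgebra k H} {M : Type v} [AddCommGroup M] [Module k M]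
  {C : Type*} [AddCommGroup C] [Module k C]

/-! ### Twisting an ordinary bimodule with a compatible automorphism -/

namespace HopfBimodule

variable (X : HopfBimodule 𝓗.untwist M) (μ : M ≃ₗ[k] M)
  (hμ : IsHom 𝓗.α.toLinearMap X X μ.toLinearMap)

/-- The bicovariant Hom-bimodule with actions `μ(h·m)`, `μ(m·h)` and coactions `ρ(μ⁻¹(m))`,
`σ(μ⁻¹(m))`. -/
noncomputable def twist : BicovariantStructure 𝓗 M where
  μ := μ
  lact := X.lact.compr₂ μ.toLinearMap
  ract := X.ract.compr₂ μ.toLinearMap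
  μ_lact h m := by simpa using hμ.map_lact h m
  μ_ract m h := by simpa using hμ.map_ract m h
  lact_lact g h m := by
    have h1 := hμ.map_lact h m
    simp only [LinearEquiv.coe_coe] at h1
    simp only [LinearMap.compr₂_apply, LinearEquiv.coe_coe, 𝓗.mul_eq, h1, 𝓗.α_untwist_mul,
      ← X.mul_lact]
  one_lact m := congrArg μ (X.one_lact m)
  ract_ract m g h := by
    have h1 := hμ.map_ract m g
    simp only [LinearEquiv.coe_coe] at h1
    simp only [LinearMap.compr₂_apply, LinearEquiv.coe_coe, 𝓗.mul_eq, h1, 𝓗.α_untwist_mul,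
      ← X.ract_mul]
  ract_one m := congrArg μ (X.ract_one m)
  lact_ract g m h := by
    have h1 := hμ.map_lact g m
    have h2 := hμ.map_ract m h
    simp only [LinearEquiv.coe_coe] at h1 h2
    simp only [LinearMap.compr₂_apply, LinearEquiv.coe_coe, h1, h2, X.lact_ract]
  ρ := X.ρ ∘ₗ μ.symm.toLinearMap
  ρ_μ m := by
    have := hμ.map_ρ (μ.symm m)
    simp only [LinearEquiv.coe_coe, LinearEquiv.apply_symm_apply] at this
    simp only [LinearMap.comp_apply, LinearEquiv.coe_coe, LinearEquiv.symm_apply_apply, map_eq_sw,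
      this]
  ρ_coassoc m := by
    have h1 := hμ.symm.map_ρ
    simp only [LinearEquiv.coe_coe] at h1
    simp (disch := fun_prop) only [LinearMap.comp_apply, LinearEquiv.coe_coe, map_eq_sw, map_sw,
      assoc_tmul_eq_sw, h1, sw_sw, sw_tmul, tmul_sw, 𝓗.comul_eq, 𝓗.sw_untwist_comul_α_symm]
    rw [X.sw_ρ_coassoc m (fun a b n => 𝓗.α.symm (𝓗.α.symm a) ⊗ₜ[k]
      (𝓗.α.symm (𝓗.α.symm b) ⊗ₜ[k] μ.symm (μ.symm n))) (by fun_prop) (by fun_prop) (by fun_prop)]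
  ρ_counit m := by
    simp only [LinearMap.comp_apply, LinearEquiv.coe_coe, rTensor_eq_sw, map_sw,
      TensorProduct.lid_tmul]
    exact X.ρ_counit _
  ρ_covariant h m g := by
    have h1 := hμ.symm.map_ρ
    have h2 := hμ.map_lact
    have h3 := hμ.map_ρ
    have h4 := hμ.map_ract
    simp only [LinearEquiv.coe_coe] at h1 h2 h3 h4
    simp (disch := fun_prop) only [LinearMap.comp_apply, LinearEquiv.coe_coe, map₂_eq_sw,
      LinearMap.compr₂_apply, LinearEquiv.symm_apply_apply, 𝓗.comul_eq, h1, h2, h3, h4, sw_sw,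
      sw_tmul, 𝓗.sw_untwist_comul_α_symm, X.ρ_ract, X.sw_ρ_lact, 𝓗.sw_untwist_comul_α, 𝓗.mul_eq,
      𝓗.α_untwist_mul, X.lact_ract, LinearEquiv.apply_symm_apply]
    simp only [← 𝓗.α_untwist_mul, ← h2, ← h4, LinearEquiv.symm_apply_apply]
  σ := X.σ ∘ₗ μ.symm.toLinearMap
  σ_μ m := by
    have := hμ.map_σ (μ.symm m)
    simp only [LinearEquiv.coe_coe, LinearEquiv.apply_symm_apply] at this
    simp only [LinearMap.comp_apply, LinearEquiv.coe_coe, LinearEquiv.symm_apply_apply, map_eq_sw,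
      this]
  σ_coassoc m := by
    have h1 := hμ.symm.map_σ
    simp only [LinearEquiv.coe_coe] at h1
    simp (disch := fun_prop) only [LinearMap.comp_apply, LinearEquiv.coe_coe, map_eq_sw, map_sw,
      assoc_tmul_eq_sw, h1, sw_sw, sw_tmul, 𝓗.comul_eq]
    have h2 := fun x : H => 𝓗.sw_untwist_comul_α_symm x (fun c d =>
      c ⊗ₜ[k] d) (by fun_prop) (by fun_prop)
    simp only [sw_tmul_self] at h2
    simp (disch := fun_prop) only [h2, tmul_sw, sw_sw, sw_tmul]
    rw [X.sw_σ_coassoc m (fun n a b => μ.symm (μ.symm n) ⊗ₜ[k]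
      (𝓗.α.symm (𝓗.α.symm a) ⊗ₜ[k] 𝓗.α.symm (𝓗.α.symm b))) (by fun_prop) (by fun_prop) (by fun_prop)]
  σ_counit m := by
    simp only [LinearMap.comp_apply, LinearEquiv.coe_coe, lTensor_eq_sw, map_sw,
      TensorProduct.rid_tmul]
    exact X.σ_counit _
  σ_covariant h m g := by
    have h1 := hμ.symm.map_σ
    have h2 := hμ.map_lact
    have h3 := hμ.map_σ
    have h4 := hμ.map_ract
    simp only [LinearEquiv.coe_coe] at h1 h2 h3 h4
    simp (disch := fun_prop) only [LinearMap.comp_apply, LinearEquiv.coe_coe, map₂_eq_sw,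
      LinearMap.compr₂_apply, LinearEquiv.symm_apply_apply, 𝓗.comul_eq, h1, h2, h3, h4, sw_sw,
      sw_tmul, 𝓗.sw_untwist_comul_α_symm, X.σ_ract, X.sw_σ_lact, 𝓗.sw_untwist_comul_α, 𝓗.mul_eq,
      𝓗.α_untwist_mul, X.lact_ract, LinearEquiv.apply_symm_apply]
    simp only [← 𝓗.α_untwist_mul, ← h2, ← h4, LinearEquiv.symm_apply_apply]
  hom_comm m := by
    have h1 := hμ.symm.map_σ
    have h2 := hμ.symm.map_ρ
    simp only [LinearEquiv.coe_coe] at h1 h2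
    simp (disch := fun_prop) only [LinearMap.comp_apply, LinearEquiv.coe_coe, map_eq_sw, map_sw,
      assoc_tmul_eq_sw, h1, h2, sw_sw, sw_tmul, tmul_sw, lTensor_eq_sw, rTensor_eq_sw,
      LinearMap.id_apply, LinearEquiv.apply_symm_apply]
    rw [X.sw_ρ_σ m (fun a p b => 𝓗.α.symm a ⊗ₜ[k] (μ.symm (μ.symm p) ⊗ₜ[k]
      𝓗.α.symm (𝓗.α.symm b))) (by fun_prop) (by fun_prop) (by fun_prop)]

/-- It identifies the untwisted form of the new tensor product object with the ordinary tensor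
product, so the ordinary formulas transfer. -/
theorem untwist_twist : (X.twist μ hμ).untwist = X := by
  apply HopfBimodule.ext
  · ext h m
    simp [BicovariantStructure.untwist, twist]
  · ext m h
    simp [BicovariantStructure.untwist, twist]
  · ext m
    simp [BicovariantStructure.untwist, twist]
  · ext m
    simp [BicovariantStructure.untwist, twist]

end HopfBimodule

/-! ### The tensor product of bicovariant Hom-bimodules as objects -/

namespace BicovariantHomBimodule

variable {k : Type u} {H : Type v} [CommRing k] [AddCommGroup H] [Module k H]
  {𝓗 : MonoidalHomHopfAlgebra k H} (M N P Q : BicovariantHomBimodule 𝓗)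

/-- The underlying ordinary bicovariant bimodule. -/
noncomputable abbrev cl : HopfBimodule 𝓗.untwist M := M.str.untwist

variable {M N} in
theorem Hom.isHom (f : M ⟶ N) : HopfBimodule.IsHom LinearMap.id M.cl N.cl f.lin where
  map_lact h m := by
    apply N.str.μ.injective
    rw [← N.str.lact_eq, ← f.map_μ, ← M.str.lact_eq, f.map_lact, LinearMap.id_apply]
  map_ract m h := by
    apply N.str.μ.injective
    rw [← N.str.ract_eq, ← f.map_μ, ← M.str.ract_eq, f.map_ract, LinearMap.id_apply]
  map_ρ m := by
    have := f.map_ρ (M.str.μ m)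
    rw [M.str.ρ_eq, N.str.ρ_eq, f.map_μ, LinearEquiv.symm_apply_apply, LinearEquiv.symm_apply_apply,
      lTensor_eq_sw] at this
    exact this
  map_σ m := by
    have := f.map_σ (M.str.μ m)
    rw [M.str.σ_eq, N.str.σ_eq, f.map_μ, LinearEquiv.symm_apply_apply, LinearEquiv.symm_apply_apply,
      rTensor_eq_sw] at this
    exact this

variable {M N} in
/-- Morphisms in terms of the underlying ordinary bimodules. -/
def homOfIsHom (f : M →ₗ[k] N) (hf : HopfBimodule.IsHom LinearMap.id M.cl N.cl f)
    (hμ : ∀ m, f (M.str.μ m) = N.str.μ (f m)) : M ⟶ N where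
  lin := f
  map_μ := hμ
  map_lact h m := by rw [M.str.lact_eq, hμ, hf.map_lact, N.str.lact_eq, LinearMap.id_apply]
  map_ract m h := by rw [M.str.ract_eq, hμ, hf.map_ract, N.str.ract_eq, LinearMap.id_apply]
  map_ρ m := by
    have h1 : N.str.μ.symm (f m) = f (M.str.μ.symm m) := by
      apply N.str.μ.injective; simp [← hμ]
    rw [M.str.ρ_eq, N.str.ρ_eq, h1, hf.map_ρ, lTensor_eq_sw]
    rfl
  map_σ m := by
    have h1 : N.str.μ.symm (f m) = f (M.str.μ.symm m) := by
      apply N.str.μ.injective; simp [← hμ]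
    rw [M.str.σ_eq, N.str.σ_eq, h1, hf.map_σ, rTensor_eq_sw]
    rfl

variable {M N} in
/-- A morphism with a linear inverse is an isomorphism. -/
def isoOfInverse (f : M ⟶ N) (g : N →ₗ[k] M) (h1 : ∀ m, g (f.lin m) = m)
    (h2 : ∀ n, f.lin (g n) = n) : M ≅ N where
  hom := f
  inv := homOfIsHom g
    (HopfBimodule.IsHom.symm (φ := LinearEquiv.refl k H)
      (f := LinearEquiv.ofLinearMap f.lin g (LinearMap.ext h2) (LinearMap.ext h1)) (Hom.isHom f))
    (fun n => by
      apply Function.LeftInverse.injective h1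
      rw [h2, f.map_μ, h2])
  hom_inv_id := Hom.ext (LinearMap.ext h1)
  inv_hom_id := Hom.ext (LinearMap.ext h2)

@[simp] theorem id_lin (m : M) : Hom.lin (𝟙 M) m = m := rfl

@[simp] theorem comp_lin {M N P : BicovariantHomBimodule 𝓗} (f : M ⟶ N) (g : N ⟶ P) (m : M) :
    (f ≫ g).lin m = g.lin (f.lin m) := rfl

/-- The tensor product over `H`. -/
noncomputable def tensor : BicovariantHomBimodule 𝓗 where
  carrier := M.cl.Tensor N.cl
  str := (M.cl.tensor N.cl).twist (HopfBimodule.tensorEquiv M.str.isHom_μ N.str.isHom_μ)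
    (HopfBimodule.isHom_tensorMap 𝓗.isEndo_α M.str.isHom_μ N.str.isHom_μ)

theorem cl_tensor : (M.tensor N).cl = M.cl.tensor N.cl :=
  HopfBimodule.untwist_twist _ _
    (HopfBimodule.isHom_tensorMap 𝓗.isEndo_α M.str.isHom_μ N.str.isHom_μ)

/-- The class of `m ⊗ n` in the ordinary tensor product over `H`. -/
noncomputable def tm : M →ₗ[k] N →ₗ[k] M.tensor N := M.cl.tmk N.cl

section
variable {M N P}

theorem μ_tm (m : M) (n : N) :
    (M.tensor N).str.μ (M.tm N m n) = M.tm N (M.str.μ m) (N.str.μ n) :=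
  HopfBimodule.tensorEquiv_mk M.str.isHom_μ N.str.isHom_μ m n

theorem tm_ract (m : M) (h : H) (n : N) :
    M.tm N (M.cl.ract m h) n = M.tm N m (N.cl.lact h n) :=
  BalancedTensor.mk_ract m h n

theorem lact_tm (h : H) (m : M) (n : N) :
    (M.tensor N).cl.lact h (M.tm N m n) = M.tm N (M.cl.lact h m) n := by
  rw [cl_tensor]; exact HopfBimodule.tensorLact_mk _ _ h m n

theorem ract_tm (m : M) (n : N) (h : H) :
    (M.tensor N).cl.ract (M.tm N m n) h = M.tm N m (N.cl.ract n h) := by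
  rw [cl_tensor]; exact HopfBimodule.tensorRact_mk _ _ h m n

theorem ρ_tm (m : M) (n : N) : (M.tensor N).cl.ρ (M.tm N m n) =
    sw (M.cl.ρ m) fun a m => sw (N.cl.ρ n) fun b n => 𝓗.untwist.mul a b ⊗ₜ[k] M.tm N m n := by
  rw [cl_tensor]; exact HopfBimodule.tensorRho_mk _ _ m n

theorem σ_tm (m : M) (n : N) : (M.tensor N).cl.σ (M.tm N m n) =
    sw (M.cl.σ m) fun m a => sw (N.cl.σ n) fun n b => M.tm N m n ⊗ₜ[k] 𝓗.untwist.mul a b := by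
  rw [cl_tensor]; exact HopfBimodule.tensorSigma_mk _ _ m n

variable {C : Type*} [AddCommGroup C] [Module k C]

theorem tensor_ext_lin {f g : M.tensor N → C} (hf : Lin k f) (hg : Lin k g)
    (h : ∀ m n, f (M.tm N m n) = g (M.tm N m n)) (x : M.tensor N) : f x = g x :=
  BalancedTensor.ext_lin (r := M.cl.ract) (l := N.cl.lact) hf hg h x

theorem tensor_hom_ext {f g : M.tensor N ⟶ P}
    (h : ∀ m n, f.lin (M.tm N m n) = g.lin (M.tm N m n)) : f = g :=
  Hom.ext (LinearMap.ext (tensor_ext_lin (by fun_prop) (by fun_prop) h))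

/-- The linear map induced by a balanced bilinear map. -/
noncomputable def tensorLift (f : M →ₗ[k] N →ₗ[k] C)
    (hf : ∀ m h n, f (M.cl.ract m h) n = f m (N.cl.lact h n)) : M.tensor N →ₗ[k] C :=
  BalancedTensor.lift f hf

@[simp] theorem tensorLift_tm (f : M →ₗ[k] N →ₗ[k] C)
    (hf : ∀ m h n, f (M.cl.ract m h) n = f m (N.cl.lact h n)) (m : M) (n : N) :
    tensorLift f hf (M.tm N m n) = f m n :=
  BalancedTensor.lift_mk f hf m n

/-- Morphisms are linear for the untwisted actions, so the generation argument by coinvariants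
applies in this category as well. -/
theorem tensor_hom_ext_of_coinvariant {f g : M.tensor N ⟶ P}
    (h : ∀ m n, M.cl.ρ m = 𝓗.untwist.one ⊗ₜ[k] m → N.cl.σ n = n ⊗ₜ[k] 𝓗.untwist.one →
      f.lin (M.tm N m n) = g.lin (M.tm N m n)) : f = g := by
  refine tensor_hom_ext fun m n => ?_
  rw [← M.cl.sw_lact_projL m, ← N.cl.sw_ract_projR n]
  simp only [map_sw, sw_apply, ← lact_tm, ← ract_tm, f.isHom.map_lact, f.isHom.map_ract,
    g.isHom.map_lact, g.isHom.map_ract, h _ _ (M.cl.ρ_projL _) (N.cl.σ_projR _)]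

end

end BicovariantHomBimodule

/-! ### Tensor product of morphisms, associativity and unit constraints -/

namespace BicovariantHomBimodule

variable {k : Type u} {H : Type v} [CommRing k] [AddCommGroup H] [Module k H]
  {𝓗 : MonoidalHomHopfAlgebra k H} {M N P Q M' N' : BicovariantHomBimodule 𝓗}

/-- `f ⊗_H g`. -/
noncomputable def tensorMap (f : M ⟶ M') (g : N ⟶ N') : M.tensor N ⟶ M'.tensor N' :=
  homOfIsHom (M := M.tensor N) (N := M'.tensor N') (HopfBimodule.tensorMap f.isHom g.isHom)
    (by
      rw [cl_tensor, cl_tensor]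
      exact HopfBimodule.isHom_tensorMap .id f.isHom g.isHom)
    (tensor_ext_lin (by fun_prop) (by fun_prop) fun m n => by
      rw [μ_tm]
      refine (HopfBimodule.tensorMap_mk f.isHom g.isHom _ _).trans ?_
      rw [f.map_μ, g.map_μ]
      refine (μ_tm _ _).symm.trans (congrArg _ ?_)
      exact (HopfBimodule.tensorMap_mk f.isHom g.isHom _ _).symm)

@[simp] theorem tensorMap_tm (f : M ⟶ M') (g : N ⟶ N') (m : M) (n : N) :
    (tensorMap f g).lin (M.tm N m n) = M'.tm N' (f.lin m) (g.lin n) :=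
  HopfBimodule.tensorMap_mk f.isHom g.isHom m n

variable (M N P)

/-- `(m ⊗ n) ⊗ p ↦ m ⊗ (n ⊗ p)`. -/
noncomputable def assocLin : (M.tensor N).tensor P →ₗ[k] M.tensor (N.tensor P) :=
  tensorLift (tensorLift (mkTrilin (fun m n p => M.tm _ m (N.tm P n p)) (by fun_prop) (by fun_prop)
      (by fun_prop)) (fun m h n => by ext p; simp [tm_ract, lact_tm]))
    (fun x h p => by
      revert x
      exact tensor_ext_lin (by fun_prop) (by fun_prop) fun m n => by simp [ract_tm, tm_ract])

/-- `m ⊗ (n ⊗ p) ↦ (m ⊗ n) ⊗ p`. -/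
noncomputable def assocInvLin : M.tensor (N.tensor P) →ₗ[k] (M.tensor N).tensor P :=
  tensorLift (tensorLift (mkTrilin (fun n p m => (M.tensor N).tm P (M.tm N m n) p) (by fun_prop)
      (by fun_prop) (by fun_prop)) (fun n h p => by ext m; simp [tm_ract, ← ract_tm])).flip
    (fun m h x => by
      revert x
      exact tensor_ext_lin (by fun_prop) (by fun_prop) fun n p => by simp [lact_tm, tm_ract])

variable {M N P}

@[simp] theorem assocLin_tm (m : M) (n : N) (p : P) :
    assocLin M N P ((M.tensor N).tm P (M.tm N m n) p) = M.tm (N.tensor P) m (N.tm P n p) := by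
  simp [assocLin]

@[simp] theorem assocInvLin_tm (m : M) (n : N) (p : P) :
    assocInvLin M N P (M.tm (N.tensor P) m (N.tm P n p)) = (M.tensor N).tm P (M.tm N m n) p := by
  simp [assocInvLin]

variable {C : Type*} [AddCommGroup C] [Module k C]

theorem tensor_left_ext_lin {f g : (M.tensor N).tensor P → C} (hf : Lin k f) (hg : Lin k g)
    (h : ∀ m n p, f ((M.tensor N).tm P (M.tm N m n) p) = g ((M.tensor N).tm P (M.tm N m n) p))
    (x : (M.tensor N).tensor P) : f x = g x :=
  tensor_ext_lin hf hg (fun y p => tensor_ext_lin (f := fun y => f ((M.tensor N).tm P y p))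
    (g := fun y => g ((M.tensor N).tm P y p)) (by fun_prop) (by fun_prop)
    (fun m n => h m n p) y) x

theorem tensor_right_ext_lin {f g : M.tensor (N.tensor P) → C} (hf : Lin k f) (hg : Lin k g)
    (h : ∀ m n p, f (M.tm _ m (N.tm P n p)) = g (M.tm _ m (N.tm P n p)))
    (x : M.tensor (N.tensor P)) : f x = g x :=
  tensor_ext_lin hf hg (fun m y => tensor_ext_lin (f := fun y => f (M.tm _ m y))
    (g := fun y => g (M.tm _ m y)) (by fun_prop) (by fun_prop)
    (fun n p => h m n p) y) x

variable (M N P)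

theorem isHom_assocLin : HopfBimodule.IsHom LinearMap.id ((M.tensor N).tensor P).cl
    (M.tensor (N.tensor P)).cl (assocLin M N P) where
  map_lact h := tensor_left_ext_lin (by fun_prop) (by fun_prop) fun m n p => by
    simp [lact_tm]
  map_ract x h := by
    revert x
    exact tensor_left_ext_lin (by fun_prop) (by fun_prop) fun m n p => by simp [ract_tm]
  map_ρ := tensor_left_ext_lin (by fun_prop) (by fun_prop) fun m n p => by
    simp (disch := fun_prop) only [assocLin_tm, ρ_tm, sw_sw, sw_tmul, LinearMap.id_apply,
      𝓗.untwist.mul_assoc]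
  map_σ := tensor_left_ext_lin (by fun_prop) (by fun_prop) fun m n p => by
    simp (disch := fun_prop) only [assocLin_tm, σ_tm, sw_sw, sw_tmul, LinearMap.id_apply,
      𝓗.untwist.mul_assoc]

/-- The ordinary associativity constraint. -/
noncomputable def assoc : (M.tensor N).tensor P ≅ M.tensor (N.tensor P) :=
  isoOfInverse (homOfIsHom (assocLin M N P) (isHom_assocLin M N P)
      (tensor_left_ext_lin (by fun_prop) (by fun_prop) fun m n p => by simp [μ_tm]))
    (assocInvLin M N P)
    (tensor_left_ext_lin (by simp only [homOfIsHom]; fun_prop) (by fun_prop)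
      fun m n p => by simp [homOfIsHom])
    (tensor_right_ext_lin (by simp only [homOfIsHom]; fun_prop) (by fun_prop)
      fun m n p => by simp [homOfIsHom])

@[simp] theorem assoc_hom_tm (m : M) (n : N) (p : P) : (assoc M N P).hom.lin
    ((M.tensor N).tm P (M.tm N m n) p) = M.tm (N.tensor P) m (N.tm P n p) :=
  assocLin_tm m n p

@[simp] theorem assoc_inv_tm (m : M) (n : N) (p : P) : (assoc M N P).inv.lin
    (M.tm (N.tensor P) m (N.tm P n p)) = (M.tensor N).tm P (M.tm N m n) p :=
  assocInvLin_tm m n p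

/-- The identification of the carrier of the regular bimodule with `H`. -/
def ofRegular (𝓗 : MonoidalHomHopfAlgebra k H) : regular 𝓗 ≃ₗ[k] H :=
  LinearEquiv.refl k H

theorem ofRegular_lact (h : H) (x : regular 𝓗) :
    ofRegular 𝓗 ((regular 𝓗).cl.lact h x) = 𝓗.untwist.mul h (ofRegular 𝓗 x) := rfl

theorem ofRegular_ract (x : regular 𝓗) (h : H) :
    ofRegular 𝓗 ((regular 𝓗).cl.ract x h) = 𝓗.untwist.mul (ofRegular 𝓗 x) h := rfl

theorem ofRegular_μ (x : regular 𝓗) :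
    ofRegular 𝓗 ((regular 𝓗).str.μ x) = 𝓗.α (ofRegular 𝓗 x) := rfl

theorem sw_comul_ofRegular (x : regular 𝓗) (F : H → H → C) :
    sw (𝓗.untwist.comul (ofRegular 𝓗 x)) F =
      sw ((regular 𝓗).cl.ρ x) fun a y => F a (ofRegular 𝓗 y) := rfl

theorem sw_comul_ofRegular' (x : regular 𝓗) (F : H → H → C) :
    sw (𝓗.untwist.comul (ofRegular 𝓗 x)) F =
      sw ((regular 𝓗).cl.σ x) fun y a => F (ofRegular 𝓗 y) a := rfl

/-- `h ⊗ m ↦ h·m`. -/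
noncomputable def leftUnitLin : (regular 𝓗).tensor M →ₗ[k] M :=
  tensorLift (M.cl.lact ∘ₗ (ofRegular 𝓗).toLinearMap) fun g h m => by
    simp [ofRegular_ract, M.cl.mul_lact]

/-- `m ⊗ h ↦ m·h`. -/
noncomputable def rightUnitLin : M.tensor (regular 𝓗) →ₗ[k] M :=
  tensorLift (M.cl.ract.flip ∘ₗ (ofRegular 𝓗).toLinearMap).flip fun m g h => by
    simp [ofRegular_lact, M.cl.ract_mul]

variable {M}

@[simp] theorem leftUnitLin_tm (x : regular 𝓗) (m : M) :
    leftUnitLin M ((regular 𝓗).tm M x m) = M.cl.lact (ofRegular 𝓗 x) m := by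
  simp [leftUnitLin]

@[simp] theorem rightUnitLin_tm (m : M) (x : regular 𝓗) :
    rightUnitLin M (M.tm (regular 𝓗) m x) = M.cl.ract m (ofRegular 𝓗 x) :=
  tensorLift_tm (M.cl.ract.flip ∘ₗ (ofRegular 𝓗).toLinearMap).flip _ m x

/-- Moving `x = 1·x` across the tensor sign shows that `m ↦ 1 ⊗ m` inverts the left unit constraint.
-/
theorem regular_tm_eq (x : regular 𝓗) (m : M) : (regular 𝓗).tm M x m =
    (regular 𝓗).tm M ((ofRegular 𝓗).symm 𝓗.untwist.one) (M.cl.lact (ofRegular 𝓗 x) m) := by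
  rw [← tm_ract]
  congr 2
  apply (ofRegular 𝓗).injective
  rw [ofRegular_ract, LinearEquiv.apply_symm_apply, 𝓗.untwist.one_mul]

theorem tm_regular_eq (m : M) (x : regular 𝓗) : M.tm (regular 𝓗) m x =
    M.tm (regular 𝓗) (M.cl.ract m (ofRegular 𝓗 x)) ((ofRegular 𝓗).symm 𝓗.untwist.one) := by
  rw [tm_ract]
  congr 1
  apply (ofRegular 𝓗).injective
  rw [ofRegular_lact, LinearEquiv.apply_symm_apply, 𝓗.untwist.mul_one]

variable (M)

theorem isHom_leftUnitLin :
    HopfBimodule.IsHom LinearMap.id ((regular 𝓗).tensor M).cl M.cl (leftUnitLin M) where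
  map_lact h := tensor_ext_lin (by fun_prop) (by fun_prop) fun g m => by
    simp [lact_tm, ofRegular_lact, M.cl.mul_lact]
  map_ract x h := by
    revert x
    exact tensor_ext_lin (by fun_prop) (by fun_prop) fun g m => by
      simp [ract_tm, M.cl.lact_ract]
  map_ρ := tensor_ext_lin (by fun_prop) (by fun_prop) fun g m => by
    simp (disch := fun_prop) only [sw_sw, sw_tmul, leftUnitLin_tm, ρ_tm, M.cl.ρ_lact,
      sw_comul_ofRegular, LinearMap.id_apply]
  map_σ := tensor_ext_lin (by fun_prop) (by fun_prop) fun g m => by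
    simp (disch := fun_prop) only [sw_sw, sw_tmul, leftUnitLin_tm, σ_tm, M.cl.σ_lact,
      sw_comul_ofRegular', LinearMap.id_apply]

theorem isHom_rightUnitLin :
    HopfBimodule.IsHom LinearMap.id (M.tensor (regular 𝓗)).cl M.cl (rightUnitLin M) where
  map_lact h := tensor_ext_lin (by fun_prop) (by fun_prop) fun m g => by
    simp [lact_tm, M.cl.lact_ract]
  map_ract x h := by
    revert x
    exact tensor_ext_lin (by fun_prop) (by fun_prop) fun m g => by
      simp [ract_tm, ofRegular_ract, M.cl.ract_mul]
  map_ρ := tensor_ext_lin (by fun_prop) (by fun_prop) fun m g => by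
    simp (disch := fun_prop) only [sw_sw, sw_tmul, rightUnitLin_tm, ρ_tm, M.cl.ρ_ract,
      sw_comul_ofRegular, LinearMap.id_apply]
  map_σ := tensor_ext_lin (by fun_prop) (by fun_prop) fun m g => by
    simp (disch := fun_prop) only [sw_sw, sw_tmul, rightUnitLin_tm, σ_tm, M.cl.σ_ract,
      sw_comul_ofRegular', LinearMap.id_apply]

/-- The left unit constraint. -/
noncomputable def leftUnit : (regular 𝓗).tensor M ≅ M :=
  isoOfInverse (homOfIsHom (leftUnitLin M) (isHom_leftUnitLin M)
      (tensor_ext_lin (by fun_prop) (by fun_prop) fun x m => by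
        rw [μ_tm, leftUnitLin_tm, leftUnitLin_tm, ofRegular_μ]
        exact (M.str.isHom_μ.map_lact _ m).symm))
    ((regular 𝓗).tm M ((ofRegular 𝓗).symm 𝓗.untwist.one))
    (tensor_ext_lin (by simp only [homOfIsHom]; fun_prop) (by fun_prop) fun h m => by
      simp only [homOfIsHom, leftUnitLin_tm, ← regular_tm_eq])
    (fun m => by simp [homOfIsHom, M.cl.one_lact])

/-- The right unit constraint. -/
noncomputable def rightUnit : M.tensor (regular 𝓗) ≅ M :=
  isoOfInverse (homOfIsHom (rightUnitLin M) (isHom_rightUnitLin M)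
      (tensor_ext_lin (by fun_prop) (by fun_prop) fun m h => by
        rw [μ_tm, rightUnitLin_tm, rightUnitLin_tm, ofRegular_μ]
        exact (M.str.isHom_μ.map_ract m _).symm))
    ((M.tm (regular 𝓗)).flip ((ofRegular 𝓗).symm 𝓗.untwist.one))
    (tensor_ext_lin (by simp only [homOfIsHom]; fun_prop) (by fun_prop) fun m h => by
      simp only [homOfIsHom, rightUnitLin_tm, LinearMap.flip_apply, ← tm_regular_eq])
    (fun m => by simp [homOfIsHom, M.cl.ract_one])

variable {M}

@[simp] theorem leftUnit_hom_tm (x : regular 𝓗) (m : M) :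
    (leftUnit M).hom.lin ((regular 𝓗).tm M x m) = M.cl.lact (ofRegular 𝓗 x) m :=
  leftUnitLin_tm x m

@[simp] theorem rightUnit_hom_tm (m : M) (x : regular 𝓗) :
    (rightUnit M).hom.lin (M.tm (regular 𝓗) m x) = M.cl.ract m (ofRegular 𝓗 x) :=
  rightUnitLin_tm m x

end BicovariantHomBimodule

/-! ### The monoidal category, its prebraiding and its braiding -/

namespace BicovariantHomBimodule

variable {k : Type u} {H : Type v} [CommRing k] [AddCommGroup H] [Module k H]
  {𝓗 : MonoidalHomHopfAlgebra k H} {M N P Q M' N' : BicovariantHomBimodule 𝓗}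

theorem tensor_left_hom_ext {f g : (M.tensor N).tensor P ⟶ Q}
    (h : ∀ m n p, f.lin ((M.tensor N).tm P (M.tm N m n) p) =
      g.lin ((M.tensor N).tm P (M.tm N m n) p)) : f = g :=
  Hom.ext (LinearMap.ext (tensor_left_ext_lin (by fun_prop) (by fun_prop) h))

theorem tensor_left_left_hom_ext {X : BicovariantHomBimodule 𝓗}
    {f g : ((M.tensor N).tensor P).tensor Q ⟶ X}
    (h : ∀ m n p q, f.lin (((M.tensor N).tensor P).tm Q ((M.tensor N).tm P (M.tm N m n) p) q) =
      g.lin (((M.tensor N).tensor P).tm Q ((M.tensor N).tm P (M.tm N m n) p) q)) : f = g :=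
  tensor_hom_ext fun y q => tensor_left_ext_lin
    (f := fun y => f.lin (((M.tensor N).tensor P).tm Q y q))
    (g := fun y => g.lin (((M.tensor N).tensor P).tm Q y q)) (by fun_prop) (by fun_prop)
    (fun m n p => h m n p q) y

theorem Hom.map_cl_lact (f : M ⟶ N) (h : H) (m : M) :
    f.lin (M.cl.lact h m) = N.cl.lact h (f.lin m) := f.isHom.map_lact h m

theorem Hom.map_cl_ract (f : M ⟶ N) (h : H) (m : M) :
    f.lin (M.cl.ract m h) = N.cl.ract (f.lin m) h := f.isHom.map_ract m h

theorem tensorMap_id : tensorMap (𝟙 M) (𝟙 N) = 𝟙 (M.tensor N) :=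
  tensor_hom_ext fun m n => tensorMap_tm _ _ m n

theorem tensorMap_comp {M'' N'' : BicovariantHomBimodule 𝓗} (f : M ⟶ M') (g : N ⟶ N')
    (f' : M' ⟶ M'') (g' : N' ⟶ N'') :
    tensorMap f g ≫ tensorMap f' g' = tensorMap (f ≫ f') (g ≫ g') :=
  tensor_hom_ext fun m n => by simp only [comp_lin, tensorMap_tm]

theorem assoc_naturality {P' : BicovariantHomBimodule 𝓗} (f : M ⟶ M') (g : N ⟶ N') (h : P ⟶ P') :
    tensorMap (tensorMap f g) h ≫ (assoc M' N' P').hom =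
      (assoc M N P).hom ≫ tensorMap f (tensorMap g h) :=
  tensor_left_hom_ext fun m n p => by simp only [comp_lin, tensorMap_tm, assoc_hom_tm]

theorem leftUnit_naturality (f : M ⟶ N) :
    tensorMap (𝟙 (regular 𝓗)) f ≫ (leftUnit N).hom = (leftUnit M).hom ≫ f :=
  tensor_hom_ext fun x m => by
    simp only [comp_lin, tensorMap_tm, leftUnit_hom_tm, id_lin, f.map_cl_lact]

theorem rightUnit_naturality (f : M ⟶ N) :
    tensorMap f (𝟙 (regular 𝓗)) ≫ (rightUnit N).hom = (rightUnit M).hom ≫ f :=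
  tensor_hom_ext fun x m => by
    simp only [comp_lin, tensorMap_tm, rightUnit_hom_tm, id_lin, f.map_cl_ract]

variable (M N P Q)

theorem tensor_pentagon : tensorMap (assoc M N P).hom (𝟙 Q) ≫ (assoc M (N.tensor P) Q).hom ≫
      tensorMap (𝟙 M) (assoc N P Q).hom =
    (assoc (M.tensor N) P Q).hom ≫ (assoc M N (P.tensor Q)).hom :=
  tensor_left_left_hom_ext fun m n p q => by
    simp only [comp_lin, tensorMap_tm, assoc_hom_tm, id_lin]

theorem tensor_triangle :
    (assoc M (regular 𝓗) N).hom ≫ tensorMap (𝟙 M) (leftUnit N).hom =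
      tensorMap (rightUnit M).hom (𝟙 N) :=
  tensor_left_hom_ext fun m x n => by
    simp only [comp_lin, tensorMap_tm, assoc_hom_tm, id_lin, leftUnit_hom_tm, rightUnit_hom_tm,
      tm_ract]

variable {M N P Q}

/-- The monoidal structure on the category of bicovariant Hom-bimodules. -/
noncomputable abbrev monoidalCategoryStruct :
    MonoidalCategoryStruct (BicovariantHomBimodule 𝓗) where
  tensorObj := tensor
  tensorUnit := regular 𝓗
  tensorHom := tensorMap
  whiskerLeft M _ _ f := tensorMap (𝟙 M) f
  whiskerRight f M := tensorMap f (𝟙 M)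
  associator := assoc
  leftUnitor := leftUnit
  rightUnitor := rightUnit

attribute [local instance] monoidalCategoryStruct

/-- The monoidal category of bicovariant Hom-bimodules. -/
noncomputable abbrev monoidalCategory : MonoidalCategory (BicovariantHomBimodule 𝓗) :=
  MonoidalCategory.ofTensorHom
    (id_tensorHom_id := fun _ _ => tensorMap_id)
    (id_tensorHom := fun _ _ _ _ => rfl)
    (tensorHom_id := fun _ _ => rfl)
    (tensorHom_comp_tensorHom := tensorMap_comp)
    (associator_naturality := assoc_naturality)
    (leftUnitor_naturality := leftUnit_naturality)
    (rightUnitor_naturality := rightUnit_naturality)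
    (pentagon := tensor_pentagon)
    (triangle := tensor_triangle)

attribute [local instance] monoidalCategory

/-! ### The prebraiding -/

variable (M N) in
/-- The prebraiding `c`. -/
noncomputable def prebraid : M.tensor N ⟶ N.tensor M :=
  homOfIsHom (M := M.tensor N) (N := N.tensor M) (M.cl.braid N.cl)
    (by
      rw [cl_tensor, cl_tensor]
      exact HopfBimodule.isHom_braid M.cl N.cl)
    (fun x => HopfBimodule.braid_tensorMap 𝓗.isEndo_α M.str.isHom_μ N.str.isHom_μ x)

theorem prebraid_tm (m : M) (n : N) : (prebraid M N).lin (M.tm N m n) =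
    sw (M.cl.ρ m) fun a m => sw (N.cl.σ n) fun n b =>
      N.tm M (N.cl.lact a (N.cl.projR n)) (M.cl.ract (M.cl.projL m) b) :=
  M.cl.braid_mk N.cl m n

/-- Left coinvariance. -/
def IsCoinvL (m : M) : Prop := M.cl.ρ m = 𝓗.untwist.one ⊗ₜ[k] m

/-- Right coinvariance. -/
def IsCoinvR (m : M) : Prop := M.cl.σ m = m ⊗ₜ[k] 𝓗.untwist.one

theorem prebraid_tm_of_coinvariant {m : M} {n : N} (hm : IsCoinvL m) (hn : IsCoinvR n) :
    (prebraid M N).lin (M.tm N m n) = N.tm M n m :=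
  M.cl.braid_mk_of_coinvariant N.cl hm hn

/-- It keeps the braiding of `M ⊗_H N` with `P` a flip on suitable generators, as the reverse
hexagon requires; the right-handed version serves the forward one. -/
theorem IsCoinvL.tm {m : M} {n : N} (hm : IsCoinvL m) (hn : IsCoinvL n) :
    IsCoinvL (M.tm N m n) := by
  unfold IsCoinvL at *
  rw [ρ_tm, hm, hn]
  simp (disch := fun_prop) only [sw_tmul, 𝓗.untwist.one_mul]

theorem IsCoinvR.tm {m : M} {n : N} (hm : IsCoinvR m) (hn : IsCoinvR n) :
    IsCoinvR (M.tm N m n) := by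
  unfold IsCoinvR at *
  rw [σ_tm, hm, hn]
  simp (disch := fun_prop) only [sw_tmul, 𝓗.untwist.one_mul]

theorem prebraid_naturality (f : M ⟶ M') (g : N ⟶ N') :
    tensorMap f g ≫ prebraid M' N' = prebraid M N ≫ tensorMap g f :=
  Hom.ext (LinearMap.ext fun x => HopfBimodule.braid_tensorMap .id f.isHom g.isHom x)

/-- These generators suit the forward hexagon, where `m` has to pass both `n` and `p`: one left
coinvariant and two right coinvariant factors. -/
theorem tensor_left_hom_ext_of_coinvariant {f g : (M.tensor N).tensor P ⟶ Q}
    (h : ∀ (m : M) (n : N) (p : P), IsCoinvL m → IsCoinvR n → IsCoinvR p →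
      f.lin ((M.tensor N).tm P (M.tm N m n) p) =
      g.lin ((M.tensor N).tm P (M.tm N m n) p)) : f = g := by
  have h1 : ∀ (m : M) (n : N) (p : P), IsCoinvR n → IsCoinvR p →
      f.lin ((M.tensor N).tm P (M.tm N m n) p) = g.lin ((M.tensor N).tm P (M.tm N m n) p) := by
    intro m n p hn hp
    rw [← M.cl.sw_lact_projL m]
    simp only [map_sw, sw_apply, ← lact_tm, Hom.map_cl_lact, h _ n p (M.cl.ρ_projL _) hn hp]
  have h2 : ∀ (m : M) (n : N) (p : P), IsCoinvR n →
      f.lin ((M.tensor N).tm P (M.tm N m n) p) = g.lin ((M.tensor N).tm P (M.tm N m n) p) := by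
    intro m n p hn
    rw [← P.cl.sw_ract_projR p]
    simp only [map_sw, ← ract_tm, Hom.map_cl_ract, h1 m n _ hn (P.cl.σ_projR _)]
  refine tensor_left_hom_ext fun m n p => ?_
  rw [← N.cl.sw_ract_projR n]
  simp only [map_sw, sw_apply, ← ract_tm]
  -- The right factor split off from `n` is absorbed into `p` by balancing. Hence arbitrary `p` had
  -- to be treated before arbitrary `n`.
  simp only [tm_ract, h2 m _ _ (N.cl.σ_projR _)]

theorem tensor_right_hom_ext_of_coinvariant {f g : M.tensor (N.tensor P) ⟶ Q}
    (h : ∀ (m : M) (n : N) (p : P), IsCoinvL m → IsCoinvL n → IsCoinvR p →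
      f.lin (M.tm _ m (N.tm P n p)) = g.lin (M.tm _ m (N.tm P n p))) : f = g := by
  have h1 : ∀ (m : M) (n : N) (p : P), IsCoinvL m → IsCoinvL n →
      f.lin (M.tm _ m (N.tm P n p)) = g.lin (M.tm _ m (N.tm P n p)) := by
    intro m n p hm hn
    rw [← P.cl.sw_ract_projR p]
    simp only [map_sw, ← ract_tm, Hom.map_cl_ract, h m n _ hm hn (P.cl.σ_projR _)]
  have h2 : ∀ (m : M) (n : N) (p : P), IsCoinvL n →
      f.lin (M.tm _ m (N.tm P n p)) = g.lin (M.tm _ m (N.tm P n p)) := by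
    intro m n p hn
    rw [← M.cl.sw_lact_projL m]
    simp only [map_sw, sw_apply, ← lact_tm, Hom.map_cl_lact, h1 _ n p (M.cl.ρ_projL _) hn]
  refine Hom.ext (LinearMap.ext (tensor_right_ext_lin (by fun_prop) (by fun_prop) fun m n p => ?_))
  rw [← N.cl.sw_lact_projL n]
  simp only [map_sw, sw_apply, ← lact_tm]
  simp only [← tm_ract, h2 _ _ p (N.cl.ρ_projL _)]

variable (M N P)

/-- On the chosen generators both composites permute the factors of `m ⊗ n ⊗ p` into `n ⊗ p ⊗ m`. -/
theorem prebraid_hexagon_forward :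
    (assoc M N P).hom ≫ prebraid M (N.tensor P) ≫ (assoc N P M).hom =
      tensorMap (prebraid M N) (𝟙 P) ≫ (assoc N M P).hom ≫ tensorMap (𝟙 N) (prebraid M P) :=
  tensor_left_hom_ext_of_coinvariant fun m n p hm hn hp => by
    simp only [comp_lin, tensorMap_tm, assoc_hom_tm, id_lin, prebraid_tm_of_coinvariant hm hn,
      prebraid_tm_of_coinvariant hm (hn.tm hp), prebraid_tm_of_coinvariant hm hp]

theorem prebraid_hexagon_reverse :
    (assoc M N P).inv ≫ prebraid (M.tensor N) P ≫ (assoc P M N).inv =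
      tensorMap (𝟙 M) (prebraid N P) ≫ (assoc M P N).inv ≫ tensorMap (prebraid M P) (𝟙 N) :=
  tensor_right_hom_ext_of_coinvariant fun m n p hm hn hp => by
    simp only [comp_lin, tensorMap_tm, assoc_inv_tm, id_lin, prebraid_tm_of_coinvariant hn hp,
      prebraid_tm_of_coinvariant (hm.tm hn) hp, prebraid_tm_of_coinvariant hm hp]

variable {M N P}

/-- Apply the counit to the second leg of `Δ(x) = 1 ⊗ x`. -/
theorem IsCoinvL.ofRegular_eq {x : regular 𝓗} (hx : IsCoinvL x) :
    ofRegular 𝓗 x = 𝓗.untwist.counit (ofRegular 𝓗 x) • 𝓗.untwist.one := by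
  have h := 𝓗.untwist.comul_counit (ofRegular 𝓗 x)
  rw [sw_comul_ofRegular x (fun a b => 𝓗.untwist.counit b • a), hx,
    sw_tmul _ _ (by fun_prop) (by fun_prop)] at h
  exact h.symm

theorem IsCoinvR.ofRegular_eq {x : regular 𝓗} (hx : IsCoinvR x) :
    ofRegular 𝓗 x = 𝓗.untwist.counit (ofRegular 𝓗 x) • 𝓗.untwist.one := by
  have h := 𝓗.untwist.counit_comul (ofRegular 𝓗 x)
  rw [sw_comul_ofRegular' x (fun a b => 𝓗.untwist.counit a • b), hx,
    sw_tmul _ _ (by fun_prop) (by fun_prop)] at h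
  exact h.symm

variable (M)

/-- On generators `x` is a scalar multiple of `1`, which acts in the same way from the left and from
the right, so flipping it changes nothing. -/
theorem prebraid_regular_left :
    prebraid (regular 𝓗) M ≫ (rightUnit M).hom = (leftUnit M).hom :=
  tensor_hom_ext_of_coinvariant fun x m hx hm => by
    rw [comp_lin, prebraid_tm_of_coinvariant hx hm, rightUnit_hom_tm, leftUnit_hom_tm,
      IsCoinvL.ofRegular_eq hx, map_smul, map_smul, LinearMap.smul_apply, M.cl.ract_one,
      M.cl.one_lact]

theorem prebraid_regular_right :
    prebraid M (regular 𝓗) ≫ (leftUnit M).hom = (rightUnit M).hom :=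
  tensor_hom_ext_of_coinvariant fun m x hm hx => by
    rw [comp_lin, prebraid_tm_of_coinvariant hm hx, rightUnit_hom_tm, leftUnit_hom_tm,
      IsCoinvR.ofRegular_eq hx, map_smul, map_smul, LinearMap.smul_apply, M.cl.ract_one,
      M.cl.one_lact]

variable {M}

/-- The prebraiding of bicovariant Hom-bimodules. -/
noncomputable def prebraiding (𝓗 : MonoidalHomHopfAlgebra k H) :
    Prebraiding (BicovariantHomBimodule 𝓗) where
  braid := prebraid
  naturality := prebraid_naturality
  hexagon_forward := prebraid_hexagon_forward
  hexagon_reverse := prebraid_hexagon_reverse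
  braid_unit_left := prebraid_regular_left
  braid_unit_right := prebraid_regular_right

theorem exists_braidedCategory (hS : Function.Bijective 𝓗.antipode) :
    ∃ b : BraidedCategory (BicovariantHomBimodule 𝓗),
      ∀ M N : BicovariantHomBimodule 𝓗, (b.braiding M N).hom = (prebraiding 𝓗).braid M N := by
  let e := fun M N : BicovariantHomBimodule 𝓗 =>
    LinearEquiv.ofBijective (M.cl.braid N.cl) (M.cl.braid_bijective N.cl hS)
  refine ⟨{ braiding := fun M N => isoOfInverse (prebraid M N) (e M N).symm.toLinearMap
              (e M N).symm_apply_apply (e M N).apply_symm_apply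
            braiding_naturality_right := fun M _ _ f => prebraid_naturality (𝟙 M) f
            braiding_naturality_left := fun f M => prebraid_naturality f (𝟙 M)
            hexagon_forward := prebraid_hexagon_forward
            hexagon_reverse := prebraid_hexagon_reverse }, fun _ _ => rfl⟩

end BicovariantHomBimodule

namespace BicovariantHomBimodule

variable {k : Type u} {H : Type v} [CommRing k] [AddCommGroup H] [Module k H]
  {𝓗 : MonoidalHomHopfAlgebra k H} {M N P M' N' : BicovariantHomBimodule 𝓗}

/-! ### Comparison with the defining data -/

variable (M N) in
/-- The projection `M ⊗ N → M ⊗_H N`. -/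
noncomputable def tensorProj : M ⊗[k] N →ₗ[k] M.tensor N :=
  TensorProduct.lift ((M.tm N).compl₁₂ M.str.μ.toLinearMap N.str.μ.toLinearMap)

@[simp] theorem tensorProj_tmul (m : M) (n : N) :
    tensorProj M N (m ⊗ₜ n) = M.tm N (M.str.μ m) (N.str.μ n) := by
  simp [tensorProj]

theorem μ_cl_lact (h : H) (m : M) :
    M.str.μ (M.cl.lact h m) = M.cl.lact (𝓗.α h) (M.str.μ m) := M.str.isHom_μ.map_lact h m

theorem μ_cl_ract (m : M) (h : H) :
    M.str.μ (M.cl.ract m h) = M.cl.ract (M.str.μ m) (𝓗.α h) := M.str.isHom_μ.map_ract m h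

theorem cl_ρ_μ (m : M) : M.cl.ρ (M.str.μ m) =
    sw (M.cl.ρ m) fun a n => 𝓗.α a ⊗ₜ[k] M.str.μ n := M.str.isHom_μ.map_ρ m

theorem cl_σ_μ (m : M) : M.cl.σ (M.str.μ m) =
    sw (M.cl.σ m) fun n a => M.str.μ n ⊗ₜ[k] 𝓗.α a := M.str.isHom_μ.map_σ m

theorem μ_cl_projL (m : M) : M.str.μ (M.cl.projL m) = M.cl.projL (M.str.μ m) :=
  M.str.isHom_μ.map_projL 𝓗.isEndo_α m

theorem μ_cl_projR (m : M) : M.str.μ (M.cl.projR m) = M.cl.projR (M.str.μ m) :=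
  M.str.isHom_μ.map_projR 𝓗.isEndo_α m

/-- The twists of the action and of the coaction combine to conjugation by `μ`, with which the
ordinary projection commutes. -/
theorem projL_eq (m : M) : M.projL m = M.cl.projL m := by
  obtain ⟨m, rfl⟩ := M.str.μ.surjective m
  rw [← μ_cl_projL, HopfBimodule.projL_apply, projL, LinearMap.comp_apply, LinearMap.comp_apply,
    M.str.ρ_eq, LinearEquiv.symm_apply_apply, rTensor_eq_sw, map_sw, map_sw]
  simp only [TensorProduct.lift.tmul, M.str.lact_eq]
  rfl

theorem projR_eq (m : M) : M.projR m = M.cl.projR m := by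
  obtain ⟨m, rfl⟩ := M.str.μ.surjective m
  rw [← μ_cl_projR, HopfBimodule.projR_apply, projR, LinearMap.comp_apply, LinearMap.comp_apply,
    M.str.σ_eq, LinearEquiv.symm_apply_apply, lTensor_eq_sw, map_sw, map_sw]
  simp only [TensorProduct.lift.tmul, M.str.ract_eq]
  rfl

theorem preBraid_tmul (m : M) (n : N) : preBraid M N (m ⊗ₜ n) =
    sw (M.str.ρ m) fun a m => sw (N.str.σ n) fun n b =>
      N.str.lact a (N.projR n) ⊗ₜ[k] M.str.ract (M.projL m) b := by
  rw [sw_comm]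
  simp only [preBraid, LinearMap.comp_apply, TensorProduct.map_tmul, lTensor_eq_sw, rTensor_eq_sw,
    sw_tmul_right, tmul_sw, map_sw, LinearEquiv.coe_coe,
    TensorProduct.tensorTensorTensorComm_tmul, TensorProduct.lift.tmul]

theorem leftCodiag_tmul (m : M) (n : N) : leftCodiag M N (m ⊗ₜ n) =
    sw (M.str.ρ m) fun a m => sw (N.str.ρ n) fun b n => 𝓗.mul a b ⊗ₜ[k] (m ⊗ₜ[k] n) := by
  conv_lhs => rw [leftCodiag, LinearMap.comp_apply, LinearMap.comp_apply, TensorProduct.map_tmul,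
    ← sw_tmul_self (M.str.ρ m), ← sw_tmul_self (N.str.ρ n)]
  rw [sw_comm]
  simp only [sw_tmul_right, tmul_sw, map_sw, LinearEquiv.coe_coe,
    TensorProduct.tensorTensorTensorComm_tmul, LinearMap.rTensor_tmul, TensorProduct.lift.tmul]

theorem rightCodiag_tmul (m : M) (n : N) : rightCodiag M N (m ⊗ₜ n) =
    sw (M.str.σ m) fun m a => sw (N.str.σ n) fun n b => (m ⊗ₜ[k] n) ⊗ₜ[k] 𝓗.mul a b := by
  conv_lhs => rw [rightCodiag, LinearMap.comp_apply, LinearMap.comp_apply, TensorProduct.map_tmul,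
    ← sw_tmul_self (M.str.σ m), ← sw_tmul_self (N.str.σ n)]
  rw [sw_comm]
  simp only [sw_tmul_right, tmul_sw, map_sw, LinearEquiv.coe_coe,
    TensorProduct.tensorTensorTensorComm_tmul, LinearMap.lTensor_tmul, TensorProduct.lift.tmul]

/-- Every twist can be collected as powers of the automorphisms on the arguments, since these
commute with the actions, coactions and projections. The one `μ` from each action and the one
inverse from each coaction match the `μ ⊗ ν` in the projection. -/
theorem prebraid_tensorProj (x : M ⊗[k] N) :
    (prebraid M N).lin (tensorProj M N x) = tensorProj N M (preBraid M N x) := by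
  suffices h : (prebraid M N).lin ∘ₗ tensorProj M N = tensorProj N M ∘ₗ preBraid M N from
    LinearMap.congr_fun h x
  refine TensorProduct.ext' fun m n => ?_
  obtain ⟨m, rfl⟩ := M.str.μ.surjective m
  obtain ⟨n, rfl⟩ := N.str.μ.surjective n
  simp (disch := fun_prop) only [LinearMap.comp_apply, tensorProj_tmul, prebraid_tm, preBraid_tmul,
    M.str.ρ_eq, N.str.σ_eq, LinearEquiv.symm_apply_apply, cl_ρ_μ, cl_σ_μ, sw_sw, sw_tmul, map_sw,
    M.str.ract_eq, N.str.lact_eq, μ_cl_lact, μ_cl_ract, projL_eq, projR_eq, μ_cl_projL, μ_cl_projR]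

variable (M N) in
theorem tensorProj_eq_comp : tensorProj M N =
    (LinearMap.range (balancedRel M.cl.ract N.cl.lact)).mkQ ∘ₗ
      (TensorProduct.congr M.str.μ N.str.μ).toLinearMap :=
  TensorProduct.ext' fun m n => tensorProj_tmul m n

theorem tensorProj_surjective : Function.Surjective (tensorProj M N) := fun y => by
  obtain ⟨x, hx⟩ := Submodule.mkQ_surjective _ y
  exact ⟨(TensorProduct.congr M.str.μ N.str.μ).symm x,
    (LinearMap.congr_fun (tensorProj_eq_comp M N) _).trans
      ((congrArg (Submodule.mkQ _) (LinearEquiv.apply_symm_apply _ x)).trans hx)⟩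

theorem tensorProj_eq_zero_iff (x : M ⊗[k] N) : tensorProj M N x = 0 ↔
    TensorProduct.congr M.str.μ N.str.μ x ∈ LinearMap.range (balancedRel M.cl.ract N.cl.lact) := by
  rw [tensorProj_eq_comp]
  exact Submodule.Quotient.mk_eq_zero _

variable (M N) in
-- Under `μ ⊗ ν` the twisted relation at `(m, h, n)` becomes the ordinary relation at `(μ²(m),
-- α²(h), ν(n))`. This substitution is bijective, so the spaces of relations correspond and the
-- kernel follows.
theorem congr_comp_coeq : (TensorProduct.congr M.str.μ N.str.μ).toLinearMap ∘ₗ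
      (coeqFst M N - coeqSnd M N) = balancedRel M.cl.ract N.cl.lact ∘ₗ
    (TensorProduct.congr (TensorProduct.congr (M.str.μ ≪≫ₗ M.str.μ) (𝓗.α ≪≫ₗ 𝓗.α))
      N.str.μ).toLinearMap := by
  ext m h n
  simp [coeqFst, coeqSnd, balancedRel, M.str.ract_eq, N.str.lact_eq, μ_cl_ract, μ_cl_lact]

theorem ker_tensorProj :
    LinearMap.ker (tensorProj M N) = LinearMap.range (coeqFst M N - coeqSnd M N) := by
  have h := congrArg LinearMap.range (congr_comp_coeq M N)
  rw [LinearMap.range_comp, LinearMap.range_comp, LinearEquiv.range, Submodule.map_top] at h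
  ext x
  rw [LinearMap.mem_ker, tensorProj_eq_zero_iff, ← h]
  exact ⟨fun ⟨y, hy, e⟩ => (TensorProduct.congr M.str.μ N.str.μ).injective e ▸ hy,
    fun hx => ⟨x, hx, rfl⟩⟩

theorem isTensorOver_tensorProj : IsTensorOver (P := M.tensor N) (tensorProj M N) where
  surjective := tensorProj_surjective
  ker_eq := ker_tensorProj
  μ_eq m n := by rw [tensorProj_tmul, tensorProj_tmul, μ_tm]
  lact_eq h m n := by
    rw [tensorProj_tmul, tensorProj_tmul, (M.tensor N).str.lact_eq, lact_tm, μ_tm, M.str.lact_eq,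
      μ_cl_lact, μ_cl_lact, μ_cl_lact, LinearEquiv.apply_symm_apply]
  ract_eq m n h := by
    rw [tensorProj_tmul, tensorProj_tmul, (M.tensor N).str.ract_eq, ract_tm, μ_tm, N.str.ract_eq,
      μ_cl_ract, μ_cl_ract, μ_cl_ract, LinearEquiv.apply_symm_apply]
  ρ_eq x := by
    suffices h : (M.tensor N).str.ρ ∘ₗ tensorProj M N =
        (tensorProj M N).lTensor H ∘ₗ leftCodiag M N from LinearMap.congr_fun h x
    refine TensorProduct.ext' fun m n => ?_
    obtain ⟨m, rfl⟩ := M.str.μ.surjective m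
    obtain ⟨n, rfl⟩ := N.str.μ.surjective n
    simp (disch := fun_prop) only [LinearMap.comp_apply, tensorProj_tmul, (M.tensor N).str.ρ_eq,
      ← μ_tm (M.str.μ m) (N.str.μ n), LinearEquiv.symm_apply_apply, ρ_tm, leftCodiag_tmul,
      M.str.ρ_eq, N.str.ρ_eq, cl_ρ_μ, sw_sw, sw_tmul, map_sw, LinearMap.lTensor_tmul, 𝓗.mul_eq,
      𝓗.α_untwist_mul]
  σ_eq x := by
    suffices h : (M.tensor N).str.σ ∘ₗ tensorProj M N =
        (tensorProj M N).rTensor H ∘ₗ rightCodiag M N from LinearMap.congr_fun h x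
    refine TensorProduct.ext' fun m n => ?_
    obtain ⟨m, rfl⟩ := M.str.μ.surjective m
    obtain ⟨n, rfl⟩ := N.str.μ.surjective n
    simp (disch := fun_prop) only [LinearMap.comp_apply, tensorProj_tmul, (M.tensor N).str.σ_eq,
      ← μ_tm (M.str.μ m) (N.str.μ n), LinearEquiv.symm_apply_apply, σ_tm, rightCodiag_tmul,
      M.str.σ_eq, N.str.σ_eq, cl_σ_μ, sw_sw, sw_tmul, map_sw, LinearMap.rTensor_tmul, 𝓗.mul_eq,
      𝓗.α_untwist_mul]

theorem tensorMap_tensorProj (f : M ⟶ M') (g : N ⟶ N') (m : M) (n : N) :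
    (tensorMap f g).lin (tensorProj M N (m ⊗ₜ n)) = tensorProj M' N' (f.lin m ⊗ₜ g.lin n) := by
  rw [tensorProj_tmul, tensorProj_tmul, tensorMap_tm, f.map_μ, g.map_μ]

/-- The projections apply the automorphism twice to `m` and `n` and once to `p` on the left, but
once to `m` and twice to `n` and `p` on the right. The twists by `μ` and by the inverse automorphism
of `P` make up the difference. -/
theorem assoc_tensorProj (m : M) (n : N) (p : P) : (assoc M N P).hom.lin
      (tensorProj (M.tensor N) P (tensorProj M N (m ⊗ₜ n) ⊗ₜ p)) =
    tensorProj M (N.tensor P) (M.str.μ m ⊗ₜ tensorProj N P (n ⊗ₜ P.str.μ.symm p)) := by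
  simp only [tensorProj_tmul, μ_tm, assoc_hom_tm, LinearEquiv.apply_symm_apply]

theorem leftUnit_tensorProj (x : regular 𝓗) (m : M) :
    (leftUnit M).hom.lin (tensorProj (regular 𝓗) M (x ⊗ₜ m)) =
      M.str.lact (ofRegular 𝓗 x) m := by
  rw [tensorProj_tmul, leftUnit_hom_tm, ofRegular_μ, M.str.lact_eq, μ_cl_lact]

theorem rightUnit_tensorProj (m : M) (x : regular 𝓗) :
    (rightUnit M).hom.lin (tensorProj M (regular 𝓗) (m ⊗ₜ x)) =
      M.str.ract m (ofRegular 𝓗 x) := by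
  rw [tensorProj_tmul, rightUnit_hom_tm, ofRegular_μ, M.str.ract_eq, μ_cl_ract]

end BicovariantHomBimodule

theorem mainTheorem3 {k : Type u} {H : Type v} [CommRing k] [AddCommGroup H] [Module k H]
    (𝓗 : MonoidalHomHopfAlgebra k H) :
    ∃ (_ : MonoidalCategory (BicovariantHomBimodule 𝓗))
      (π : ∀ M N : BicovariantHomBimodule 𝓗,
        TensorProduct k M N →ₗ[k] (M ⊗ N : BicovariantHomBimodule 𝓗))
      (ι : BicovariantHomBimodule.regular 𝓗 ≅ 𝟙_ (BicovariantHomBimodule 𝓗))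
      (c : Prebraiding (BicovariantHomBimodule 𝓗)),
      (∀ M N : BicovariantHomBimodule 𝓗, BicovariantHomBimodule.IsTensorOver (π M N)) ∧
      (∀ {M M' N N' : BicovariantHomBimodule 𝓗} (f : M ⟶ M') (g : N ⟶ N') (m : M) (n : N),
        (f ⊗ₘ g).lin (π M N (m ⊗ₜ n)) = π M' N' (f.lin m ⊗ₜ g.lin n)) ∧
      (∀ (M N P : BicovariantHomBimodule 𝓗) (m : M) (n : N) (p : P),
        (α_ M N P).hom.lin (π (M ⊗ N) P (π M N (m ⊗ₜ n) ⊗ₜ p)) =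
          π M (N ⊗ P) (M.str.μ m ⊗ₜ π N P (n ⊗ₜ P.str.μ.symm p))) ∧
      (∀ (M : BicovariantHomBimodule 𝓗) (h : H) (m : M),
        (λ_ M).hom.lin (π _ M (ι.hom.lin h ⊗ₜ m)) = M.str.lact h m) ∧
      (∀ (M : BicovariantHomBimodule 𝓗) (m : M) (h : H),
        (ρ_ M).hom.lin (π M _ (m ⊗ₜ ι.hom.lin h)) = M.str.ract m h) ∧
      (∀ (M N : BicovariantHomBimodule 𝓗) (x : TensorProduct k M N),
        (c.braid M N).lin (π M N x) = π N M (BicovariantHomBimodule.preBraid M N x)) ∧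
      (Function.Bijective 𝓗.antipode →
        ∃ b : BraidedCategory (BicovariantHomBimodule 𝓗),
          ∀ M N : BicovariantHomBimodule 𝓗, (b.braiding M N).hom = c.braid M N) :=
  -- The unit object is `(H, α)` itself, so the comparison isomorphism is the identity.
  ⟨BicovariantHomBimodule.monoidalCategory, BicovariantHomBimodule.tensorProj, Iso.refl _,
    BicovariantHomBimodule.prebraiding 𝓗,
    fun _ _ => BicovariantHomBimodule.isTensorOver_tensorProj,
    BicovariantHomBimodule.tensorMap_tensorProj,
    fun _ _ _ => BicovariantHomBimodule.assoc_tensorProj,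
    fun _ => BicovariantHomBimodule.leftUnit_tensorProj,
    fun _ => BicovariantHomBimodule.rightUnit_tensorProj,
    fun _ _ => BicovariantHomBimodule.prebraid_tensorProj,
    BicovariantHomBimodule.exists_braidedCategory⟩
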